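/- Let $2^{[0,1]}$ be the set of nonempty compact subsets of $[0,1]$, and let $f:[0,1]\to 2^{[0,1]}$ be upper semicontinuous: for every $x$ and every open $U\supseteq f(x)$ there is an open $V\ni x$ with $f(v)\subseteq U$ for all $v\in V$. Suppose $f$ has the intermediate value property: whenever $x_1\neq x_2$, $y_1\in f(x_1)$, $y_2\in f(x_2)$, $y_1\ne y_2$ and $y$ lies strictly between $y_1$ and $y_2$, there is $x$ strictly between $x_1$ and $x_2$ with $y\in f(x)$. Definitions. - $G(f)=\{(x,y)\in[0,1]^2: y\in f(x)\}$, $\operatorname{int}G(f)$ is its interior in $[0,1]^2$, $\pi_1$ is the projection to the first coordinate, and $D=[0,1]\setminus\pi_1[\operatorname{int}G(f)]$. - $f|_D$ is *almost nonfissile* if the set of points $(x,y)$ of $G(f|_D)=\{(x,y): x\in D,\ y\in f(x)\}$ for which $f(x)$ is a single point is a dense $G_\delta$ subset of $G(f|_D)$. It is *light* if for every $y\in[0,1]$ the set $\{x\in D: y\in f(x)\}$ has empty interior in $[0,1]$. - A *periodic cycle of period $n$* is given by a sequence $(x_i)_{i\ge0}$ in $[0,1]$ with $x_{i+1}\in f(x_i)$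 for all $i$, such that $n$ is the smallest positive integer with $x_{n+i}=x_i$ for all $i$. (The number $1=2^0$ is a power of $2$.) - $X=\varprojlim\{[0,1],f\}=\{(x_0,x_1,\dots): x_i\in f(x_{i+1})\text{ for all } i\ge 0\}$, with the topology inherited from the product $[0,1]^{\{0,1,2,\dots\}}$. - A *continuum* is a nonempty compact connected set. It is *indecomposable* if it has more than one point and is not the union of two proper subcontinua. The continuum $X$ is *irreducible between $x,y\in X$* if no proper subcontinuum of $X$ contains both $x$ and $y$. - $f$ is *organic* if, for all $x,y\in X$ such that $X$ is irreducible between $x$ and $y$, there is $n\geq1$ with $f^n[\overline{x_ny_n}]=[0,1]$. Here $\overline{x_ny_n}$ is the closed interval with endpoints $x_n,y_n$, and $f[A]=\bigcup_{a\in A}f(a)$. Then: 1. If $f|_D$ is almost nonfissile and light, and $f$ has a periodic cycle whose period is not a power of $2$, then $X$ has an indecomposable subcontinuum. 2. If $f$ is organic and $X$ is indecomposable, then $f$ has a periodic cycle whose period is not a power of $2$. -/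

import Mathlib

open unitInterval
open TopologicalSpace (NonemptyCompacts)

namespace SetValued

section General

variable {X Y : Type*}

/-- A continuum, as a subset of an ambient (metrizable) space: compact, connected, nonempty
(`IsConnected` includes nonemptiness). -/
def IsContinuum [TopologicalSpace X] (K : Set X) : Prop :=
  IsCompact K ∧ IsConnected K

/-- `K` is an indecomposable continuum: a nondegenerate continuum that is not the union of two
proper subcontinua. -/
def IsIndecomposable [TopologicalSpace X] (K : Set X) : Prop :=
  IsContinuum K ∧ K.Nontrivial ∧
    ∀ A B : Set X, IsContinuum A → IsContinuum B → A ∪ B = K → A = K ∨ B = K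

/-- The continuum `K` is irreducible between its points `x` and `y`: the only subcontinuum of `K`
containing both `x` and `y` is `K` itself. -/
def IsIrreducibleBetween [TopologicalSpace X] (K : Set X) (x y : X) : Prop :=
  IsContinuum K ∧ x ∈ K ∧ y ∈ K ∧
    ∀ A : Set X, A ⊆ K → IsContinuum A → x ∈ A → y ∈ A → A = K

/-- Upper semicontinuity of `f : X → 2^Y`: for every open `U ⊇ f x` there is a neighbourhood of `x`
all of whose points `v` satisfy `f v ⊆ U`. -/
def IsUSC [TopologicalSpace X] [TopologicalSpace Y] (f : X → NonemptyCompacts Y) : Prop :=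
  UpperHemicontinuous fun x => (f x : Set Y)

/-- The graph `G(f)` of `f : X → 2^Y`. -/
def graph [TopologicalSpace Y] (f : X → NonemptyCompacts Y) : Set (X × Y) :=
  {p | p.2 ∈ f p.1}

/-- The point `x` is a fissile point of `f`, i.e. `f x` has more than one element. -/
def IsFissile [TopologicalSpace Y] (f : X → NonemptyCompacts Y) (x : X) : Prop :=
  (f x : Set Y).Nontrivial

/-- `f` is almost nonfissile: the nonfissile points of `G(f)` form a dense `G_δ` subset of the
space `G(f)`. -/
def IsAlmostNonfissile [TopologicalSpace X] [TopologicalSpace Y]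
    (f : X → NonemptyCompacts Y) : Prop :=
  IsGδ {p : graph f | ¬ IsFissile f p.1.1} ∧ Dense {p : graph f | ¬ IsFissile f p.1.1}

/-- The image `f[A]`, the union of the sets `f x` for `x ∈ A`. -/
def image [TopologicalSpace Y] (f : X → NonemptyCompacts Y) (A : Set X) : Set Y :=
  ⋃ x ∈ A, (f x : Set Y)

/-- An orbit of `f : X → 2^X`. -/
def IsOrbit [TopologicalSpace X] (f : X → NonemptyCompacts X) (x : ℕ → X) : Prop :=
  ∀ i, x (i + 1) ∈ f (x i)

/-- `f` has a periodic cycle of period `n`: a periodic orbit for which `n` is the smallest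
positive integer with `x (n + i) = x i` for all `i`. -/
def HasCycleOfPeriod [TopologicalSpace X] (f : X → NonemptyCompacts X) (n : ℕ) : Prop :=
  ∃ x : ℕ → X, IsOrbit f x ∧ IsLeast {m : ℕ | 0 < m ∧ ∀ i, x (m + i) = x i} n

/-- The inverse limit of the constant inverse sequence with bonding function `f`, as a subset of
the product space `ℕ → X`. -/
def inverseLimit [TopologicalSpace X] (f : X → NonemptyCompacts X) : Set (ℕ → X) :=
  {x | ∀ i, x i ∈ f (x (i + 1))}

end General

section Interval

/-- The intermediate value property of `f : [0,1] → 2^[0,1]`; `Set.uIoo a b` is the set of points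
strictly between `a` and `b`. -/
def HasIVP (f : I → NonemptyCompacts I) : Prop :=
  ∀ x₁ x₂ : I, x₁ ≠ x₂ → ∀ y₁ ∈ f x₁, ∀ y₂ ∈ f x₂, ∀ y ∈ Set.uIoo y₁ y₂,
    ∃ x ∈ Set.uIoo x₁ x₂, y ∈ f x

/-- A function `f : D → 2^[0,1]` with `D ⊆ [0,1]` is light if for every `y` the set
`{x ∈ D : y ∈ f x}` has empty interior in `[0,1]`. -/
def IsLight {D : Set I} (f : D → NonemptyCompacts I) : Prop :=
  ∀ y : I, interior ((↑) '' {x : D | y ∈ f x} : Set I) = ∅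

/-- `f : [0,1] → 2^[0,1]` is organic: whenever the inverse limit is irreducible between two of its
points `x` and `y`, some iterate `f^n`, `n ≥ 1`, maps the closed interval with endpoints `x n` and
`y n` onto `[0,1]`. -/
def IsOrganic (f : I → NonemptyCompacts I) : Prop :=
  ∀ x ∈ inverseLimit f, ∀ y ∈ inverseLimit f, IsIrreducibleBetween (inverseLimit f) x y →
    ∃ n : ℕ, 0 < n ∧ (image f)^[n] (Set.uIcc (x n) (y n)) = Set.univ

/-- The set `[0,1] \ π₁[int G(f)]`, the interior being taken in `[0,1] × [0,1]`. -/
def thinDomain (f : I → NonemptyCompacts I) : Set I :=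
  (Prod.fst '' interior (graph f))ᶜ

end Interval

end SetValued

open Set Filter Topology

namespace SetValued

/-! Upper semicontinuity and the intermediate value property make every `f x` an interval, so `f`
and its iterates carry intervals to intervals, and covering arguments work as for continuous maps.

Part 1. Write the period as `2 ^ k * m` with `m` odd and not 1. Under the iterate `2 ^ k` of `f`
some point of the cycle has a nonconstant orbit of odd length, which forces two nonoverlapping
intervals `[a, b]`, `[c, d]` that some iterate spreads over `[a, d]` (`exists_horseshoe`). Suppose
first that coordinate 0 of `X` takes values only in the thin domain. There density of nonfissile
points shows that a subcontinuum covering an interval in one coordinate covers its image in the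
previous one (`image_subset_eval`); lightness keeps the intervals nondegenerate so that this can be
iterated. A minimal subcontinuum covering `[a, d]` in all the relevant coordinates is then
indecomposable: if it is a union of two continua, one of them covers `[a, b]` or `[c, d]` in
infinitely many coordinates, hence `[a, d]` in all of them (`exists_isIndecomposable_of_horseshoe`).
Otherwise the graph contains a box over an interval of values of coordinate 0, and `X` contains a
copy of `Z × [0,1]` for a nondegenerate continuum `Z`. Such a product contains an indecomposable
continuum, found by pulling back a planar horseshoe (`exists_isIndecomposable_prod`).

Part 2. By Baire's theorem an indecomposable `X` has four points between any two of which it is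
irreducible. Organicity gives one `n` for which the iterate `n` spreads the interval between any two
of their `n`-th coordinates over `[0,1]`. Sort these coordinates. If the middle two differ, there
are two disjoint intervals that both spread over everything; if they agree, a single point does.
Either way there is a closed walk of length `3 * n` that is not a threefold repetition. Its minimal
period divides `3 * n` but not `n`, so it is not a power of two (`exists_cycle_of_closed_walk`). -/

/-! ### Continua in Hausdorff spaces. -/

/-- A compact relation with nonempty connected fibres over a connected compact set is connected. -/
theorem isPreconnected_of_fibers {α β : Type*} [TopologicalSpace α] [TopologicalSpace β]
    [T2Space α] [T2Space β] {C : Set α} {E : Set (α × β)} (hE : IsCompact E)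
    (hC : IsPreconnected C) (hsub : ∀ p ∈ E, p.1 ∈ C)
    (hne : ∀ c ∈ C, {b | (c, b) ∈ E}.Nonempty)
    (hfib : ∀ c ∈ C, IsPreconnected {b | (c, b) ∈ E}) : IsPreconnected E := by
  rw [isPreconnected_iff_subset_of_fully_disjoint_closed hE.isClosed]
  intro u v hu hv huv hd
  -- No fibre is split by the separation, so the projections of its two halves are disjoint closed
  -- sets covering `C`.
  have key : ∀ c ∈ C, (∀ b, (c, b) ∈ E → (c, b) ∈ u) ∨ (∀ b, (c, b) ∈ E → (c, b) ∈ v) := by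
    intro c hc
    have hcont : Continuous fun b : β => (c, b) := by fun_prop
    have := (hfib c hc).image (fun b => (c, b)) hcont.continuousOn
    rw [isPreconnected_iff_subset_of_disjoint_closed] at this
    rcases this u v hu hv (by rintro _ ⟨b, hb, rfl⟩; exact huv hb)
      (by rw [hd.inter_eq, inter_empty]) with h | h
    · exact Or.inl fun b hb => h ⟨b, hb, rfl⟩
    · exact Or.inr fun b hb => h ⟨b, hb, rfl⟩
  have h1 : IsClosed (Prod.fst '' (E ∩ u)) := ((hE.inter_right hu).image continuous_fst).isClosed
  have h2 : IsClosed (Prod.fst '' (E ∩ v)) := ((hE.inter_right hv).image continuous_fst).isClosed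
  have hcov : C ⊆ Prod.fst '' (E ∩ u) ∪ Prod.fst '' (E ∩ v) := by
    intro c hc
    obtain ⟨b, hb⟩ := hne c hc
    rcases key c hc with k | k
    · exact Or.inl ⟨(c, b), ⟨hb, k b hb⟩, rfl⟩
    · exact Or.inr ⟨(c, b), ⟨hb, k b hb⟩, rfl⟩
  have hdis : C ∩ (Prod.fst '' (E ∩ u) ∩ Prod.fst '' (E ∩ v)) = ∅ := by
    rw [eq_empty_iff_forall_notMem]
    rintro c ⟨hc, ⟨⟨c', b⟩, ⟨h3, h4⟩, h5⟩, ⟨⟨c'', b'⟩, ⟨h3', h4'⟩, h5'⟩⟩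
    obtain rfl : c' = c := h5
    obtain rfl : c'' = c' := h5'
    rcases key _ hc with k | k
    · exact disjoint_left.1 hd (k _ h3') h4'
    · exact disjoint_left.1 hd h4 (k _ h3)
  rw [isPreconnected_iff_subset_of_disjoint_closed] at hC
  rcases hC _ _ h1 h2 hcov hdis with h | h
  · left
    rintro ⟨c, b⟩ hp
    obtain ⟨⟨c', b'⟩, ⟨h3, h4⟩, h5⟩ := h (hsub _ hp)
    obtain rfl : c' = c := h5
    rcases key _ (hsub _ hp) with k | k
    · exact k b hp
    · exact absurd (k _ h3) (disjoint_left.1 hd h4)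
  · right
    rintro ⟨c, b⟩ hp
    obtain ⟨⟨c', b'⟩, ⟨h3, h4⟩, h5⟩ := h (hsub _ hp)
    obtain rfl : c' = c := h5
    rcases key _ (hsub _ hp) with k | k
    · exact absurd h4 (disjoint_left.1 hd (k _ h3))
    · exact k b hp

/-- In a compact Hausdorff space, two closed sets are either joined by a component or separated
by a clopen set. -/
theorem exists_isConnected_or_isClopen {Y : Type*} [TopologicalSpace Y] [CompactSpace Y]
    [T2Space Y] {A B : Set Y} (hA : IsClosed A) (hB : IsClosed B) :
    (∃ C : Set Y, IsClosed C ∧ IsConnected C ∧ (C ∩ A).Nonempty ∧ (C ∩ B).Nonempty) ∨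
      ∃ U : Set Y, IsClopen U ∧ A ⊆ U ∧ Disjoint U B := by
  by_cases h : ∃ a ∈ A, ∃ b ∈ B, (ConnectedComponents.mk a) = ConnectedComponents.mk b
  · obtain ⟨a, ha, b, hb, hab⟩ := h
    left
    refine ⟨connectedComponent a, isClosed_connectedComponent, isConnected_connectedComponent,
      ⟨a, mem_connectedComponent, ha⟩, ⟨b, ?_, hb⟩⟩
    exact ConnectedComponents.coe_eq_coe'.1 hab.symm
  · right
    push Not at h
    -- The space of components is compact and totally disconnected, so clopen sets separate disjoint
    -- closed sets there.
    let m : Y → ConnectedComponents Y := ConnectedComponents.mk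
    have hm : Continuous m := ConnectedComponents.continuous_coe
    have h1 : IsClosed (m '' A) := (hA.isCompact.image hm).isClosed
    have h2 : IsClosed (m '' B) := (hB.isCompact.image hm).isClosed
    obtain ⟨V, hV, hAV, hVB⟩ := exists_clopen_of_closed_subset_open h1 h2.isOpen_compl (by
      rintro _ ⟨a, ha, rfl⟩ ⟨b, hb, hab⟩
      exact h a ha b hb hab.symm)
    refine ⟨m ⁻¹' V, hV.preimage hm, fun a ha => hAV ⟨a, ha, rfl⟩, ?_⟩
    rw [disjoint_left]
    intro b hb hb'
    exact hVB hb ⟨b, hb', rfl⟩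

/-- The same alternative inside a compact subset of a Hausdorff space. -/
theorem exists_isContinuum_or_separation {Y : Type*} [TopologicalSpace Y] [T2Space Y]
    {S A B : Set Y} (hS : IsCompact S) (hA : IsClosed A) (hB : IsClosed B) :
    (∃ C ⊆ S, IsContinuum C ∧ (C ∩ A).Nonempty ∧ (C ∩ B).Nonempty) ∨
      ∃ P Q : Set Y, IsCompact P ∧ IsCompact Q ∧ Disjoint P Q ∧ P ∪ Q = S ∧ S ∩ A ⊆ P ∧
        S ∩ B ⊆ Q := by
  have := isCompact_iff_compactSpace.1 hS
  rcases exists_isConnected_or_isClopen (Y := S) (hA.preimage continuous_subtype_val)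
    (hB.preimage continuous_subtype_val) with ⟨C, h1, h2, ⟨a, ha, ha'⟩, ⟨b, hb, hb'⟩⟩ | ⟨U, hU, h1, h2⟩
  · left
    refine ⟨Subtype.val '' C, by rintro _ ⟨x, -, rfl⟩; exact x.2,
      ⟨h1.isCompact.image continuous_subtype_val,
        h2.image _ continuous_subtype_val.continuousOn⟩, ⟨a, ⟨a, ha, rfl⟩, ha'⟩, ⟨b, ⟨b, hb, rfl⟩, hb'⟩⟩
  · right
    refine ⟨Subtype.val '' U, Subtype.val '' Uᶜ, hU.isClosed.isCompact.image continuous_subtype_val,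
      hU.compl.isClosed.isCompact.image continuous_subtype_val, ?_, ?_, ?_, ?_⟩
    · exact (disjoint_image_iff Subtype.val_injective).2 disjoint_compl_right
    · rw [← image_union, union_compl_self, image_univ, Subtype.range_coe]
    · rintro x ⟨hx, hxA⟩
      exact ⟨⟨x, hx⟩, h1 hxA, rfl⟩
    · rintro x ⟨hx, hxB⟩
      exact ⟨⟨x, hx⟩, fun h => disjoint_left.1 h2 h hxB, rfl⟩

/-- A continuous image of a connected
set in a linear order contains the interval between any two of its values. -/
theorem Icc_subset_image {α β : Type*} [TopologicalSpace α] [LinearOrder β] [TopologicalSpace β]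
    [OrderClosedTopology β] {A : Set α} (hA : IsPreconnected A) {g : α → β} (hg : Continuous g)
    {x y : α} (hx : x ∈ A) (hy : y ∈ A) {a b : β} (ha : g x ≤ a) (hb : b ≤ g y) :
    Icc a b ⊆ g '' A :=
  (Icc_subset_Icc ha hb).trans (hA.intermediate_value hx hy hg.continuousOn)

/-- Limits of sequences of continua along an ultrafilter. -/
theorem exists_limit_continuum {α : Type*} [TopologicalSpace α] [CompactSpace α] [T2Space α]
    (C : ℕ → Set α) (hC : ∀ n, IsConnected (C n)) :
    ∃ S : Set α, IsContinuum S ∧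
      (∀ Q, IsClosed Q → (∀ᶠ n in atTop, (C n ∩ Q).Nonempty) → (S ∩ Q).Nonempty) ∧
      (∀ Q, IsClosed Q → (∀ᶠ n in atTop, C n ⊆ Q) → S ⊆ Q) := by
  set 𝒰 : Ultrafilter ℕ := Filter.hyperfilter ℕ with h𝒰
  have hle : (𝒰 : Filter ℕ) ≤ atTop := Nat.hyperfilter_le_atTop
  let S : Set α := {x | ∀ U ∈ 𝓝 x, ∀ᶠ n in 𝒰, (C n ∩ U).Nonempty}
  have meet : ∀ Q, IsClosed Q → (∀ᶠ n in 𝒰, (C n ∩ Q).Nonempty) → (S ∩ Q).Nonempty := by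
    intro Q hQ h
    classical
    obtain ⟨y, hy⟩ : ∃ y : ℕ → α, ∀ n, (C n ∩ Q).Nonempty → y n ∈ C n ∩ Q := by
      choose z hz using fun n => (hC n).nonempty
      refine ⟨fun n => if h : (C n ∩ Q).Nonempty then h.some else z n, fun n hn => ?_⟩
      simp only [hn, dif_pos]
      exact hn.some_mem
    obtain ⟨x, -, hx⟩ := isCompact_univ.ultrafilter_le_nhds (𝒰.map y) (by simp)
    have hx' : Tendsto y 𝒰 (𝓝 x) := hx
    refine ⟨x, fun U hU => ?_, ?_⟩
    · filter_upwards [hx' hU, h] with n h1 h2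
      exact ⟨y n, (hy n h2).1, h1⟩
    · exact hQ.mem_of_tendsto hx' (h.mono fun n hn => (hy n hn).2)
  have sub : ∀ Q, IsClosed Q → (∀ᶠ n in 𝒰, C n ⊆ Q) → S ⊆ Q := by
    intro Q hQ h x hx
    by_contra hxQ
    obtain ⟨n, h1, ⟨y, h2, h3⟩⟩ := (h.and (hx Qᶜ (hQ.isOpen_compl.mem_nhds hxQ))).exists
    exact h3 (h1 h2)
  have hSc : IsClosed S := by
    rw [← isOpen_compl_iff, isOpen_iff_mem_nhds]
    intro x hx
    simp only [S, mem_compl_iff, mem_ofPred_eq, not_forall] at hx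
    obtain ⟨U, hU, hn⟩ := hx
    obtain ⟨V, hVU, hV, hxV⟩ := mem_nhds_iff.1 hU
    refine mem_of_superset (hV.mem_nhds hxV) fun y hy hyS => hn ?_
    exact (hyS V (hV.mem_nhds hy)).mono fun n h => h.mono (inter_subset_inter_right _ hVU)
  refine ⟨S, ⟨hSc.isCompact, ?_, ?_⟩, fun Q hQ h => meet Q hQ (hle h),
    fun Q hQ h => sub Q hQ (hle h)⟩
  · obtain ⟨x, hx, -⟩ := meet univ isClosed_univ (Eventually.of_forall fun n => by
      simpa using (hC n).nonempty)
    exact ⟨x, hx⟩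
  · rw [isPreconnected_iff_subset_of_fully_disjoint_closed hSc]
    intro u v hu hv huv hd
    obtain ⟨U, V, hU, hV, huU, hvV, hUV⟩ := normal_separation hu hv hd
    have hev : ∀ᶠ n in 𝒰, C n ⊆ U ∪ V := by
      by_contra hcon
      rw [← Ultrafilter.eventually_not] at hcon
      obtain ⟨x, hx, hx'⟩ := meet (U ∪ V)ᶜ (hU.union hV).isClosed_compl (hcon.mono fun n hn => by
        obtain ⟨x, hx, hx'⟩ := not_subset.1 hn
        exact ⟨x, hx, hx'⟩)
      exact hx' ((union_subset_union huU hvV) (huv hx))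
    -- Each connected `C n` chooses a side, and the ultrafilter makes almost all of them choose the
    -- same one.
    have hev2 : ∀ᶠ n in 𝒰, C n ⊆ U ∨ C n ⊆ V := hev.mono fun n hn =>
      (isPreconnected_iff_subset_of_disjoint.1 (hC n).isPreconnected) U V hU hV hn
        (by rw [hUV.inter_eq, inter_empty])
    have aux : ∀ U V u v : Set α, IsOpen V → u ⊆ U → v ⊆ V → Disjoint U V → S ⊆ u ∪ v →
        (∀ᶠ n in 𝒰, C n ⊆ U) → S ⊆ u := by
      intro U V u v hV huU hvV hUV huv h x hx
      rcases huv hx with h' | h'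
      · exact h'
      · obtain ⟨n, h1, ⟨y, h2, h3⟩⟩ := (h.and (hx V (hV.mem_nhds (hvV h')))).exists
        exact absurd h3 (disjoint_left.1 hUV (h1 h2))
    rcases Ultrafilter.eventually_or.1 hev2 with h | h
    · exact Or.inl (aux U V u v hV huU hvV hUV huv h)
    · exact Or.inr (aux V U v u hU hvV huU hUV.symm (by rwa [union_comm]) h)

theorem IsContinuum.image {α β : Type*} [TopologicalSpace α] [TopologicalSpace β] {A : Set α}
    (hA : IsContinuum A) {g : α → β} (hg : ContinuousOn g A) : IsContinuum (g '' A) :=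
  ⟨hA.1.image_of_continuousOn hg, hA.2.image g hg⟩

/-- Indecomposability is preserved by maps that are continuous and injective on the continuum. -/
theorem IsIndecomposable.image {α β : Type*} [TopologicalSpace α] [TopologicalSpace β] [T2Space β]
    {K : Set α} (hK : IsIndecomposable K) {g : α → β} (hg : Continuous g) (hi : InjOn g K) :
    IsIndecomposable (g '' K) := by
  obtain ⟨h1, h2, h3⟩ := hK
  have pull : ∀ A : Set β, IsContinuum A → A ⊆ g '' K → IsContinuum (K ∩ g ⁻¹' A) := by
    intro A hA hAK
    have := isCompact_iff_compactSpace.1 h1.1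
    have hemb : IsClosedEmbedding (K.domRestrict g) :=
      (hg.comp continuous_subtype_val).isClosedEmbedding
        (fun x y hxy => Subtype.ext (hi x.2 y.2 hxy))
    have hr : A ⊆ range (K.domRestrict g) := by
      intro a ha; obtain ⟨x, hx, rfl⟩ := hAK ha; exact ⟨⟨x, hx⟩, rfl⟩
    have hc : IsConnected (K.domRestrict g ⁻¹' A) :=
      hA.2.preimage_of_isClosedMap hemb.injective hemb.isClosedMap hr
    have heq : K ∩ g ⁻¹' A = Subtype.val '' (K.domRestrict g ⁻¹' A) := by
      ext x; constructor
      · rintro ⟨hx, hx'⟩; exact ⟨⟨x, hx⟩, hx', rfl⟩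
      · rintro ⟨y, hy, rfl⟩; exact ⟨y.2, hy⟩
    refine ⟨?_, ?_⟩
    · rw [heq]
      exact ((hA.1.isClosed.preimage hemb.continuous).isCompact).image continuous_subtype_val
    · rw [heq]; exact hc.image _ continuous_subtype_val.continuousOn
  refine ⟨h1.image hg.continuousOn, h2.image_of_injOn hi, fun A B hA hB hAB => ?_⟩
  have hAs : A ⊆ g '' K := hAB ▸ subset_union_left
  have hBs : B ⊆ g '' K := hAB ▸ subset_union_right
  have back : ∀ A : Set β, A ⊆ g '' K → K ∩ g ⁻¹' A = K → A = g '' K := by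
    intro A hA h
    refine hA.antisymm ?_
    rintro _ ⟨x, hx, rfl⟩
    exact (h.symm ▸ hx : x ∈ K ∩ g ⁻¹' A).2
  rcases h3 _ _ (pull A hA hAs) (pull B hB hBs) (by
    rw [← inter_union_distrib_left, ← preimage_union, hAB]
    exact inter_eq_left.2 (subset_preimage_image g K)) with h | h
  · exact Or.inl (back A hAs h)
  · exact Or.inr (back B hBs h)

/-- A directed intersection of continua is a continuum. -/
theorem isContinuum_iInter {α ι : Type*} [TopologicalSpace α] [T2Space α] [Nonempty ι]
    {V : ι → Set α} (hd : Directed (· ⊇ ·) V) (hV : ∀ i, IsContinuum (V i)) :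
    IsContinuum (⋂ i, V i) := by
  have hc : IsCompact (⋂ i, V i) :=
    (hV (Classical.arbitrary ι)).1.of_isClosed_subset
      (isClosed_iInter fun i => (hV i).1.isClosed) (iInter_subset _ _)
  refine ⟨hc, IsCompact.nonempty_iInter_of_directed_nonempty_isCompact_isClosed V hd
    (fun i => (hV i).2.nonempty) (fun i => (hV i).1) (fun i => (hV i).1.isClosed), ?_⟩
  rw [isPreconnected_iff_subset_of_fully_disjoint_closed hc.isClosed]
  intro u v hu hv huv huvd
  obtain ⟨U, W, hU, hW, hUu, hWv, hUW⟩ := SeparatedNhds.of_isCompact_isCompact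
    (hc.inter_right hu) (hc.inter_right hv) (huvd.mono inter_subset_right inter_subset_right)
  obtain ⟨i, hi⟩ := exists_subset_nhds_of_isCompact' hd (fun i => (hV i).1)
    (fun i => (hV i).1.isClosed) (U := U ∪ W) (fun x hx => (hU.union hW).mem_nhds (by
      rcases huv hx with h | h
      · exact Or.inl (hUu ⟨hx, h⟩)
      · exact Or.inr (hWv ⟨hx, h⟩)))
  rcases (isPreconnected_iff_subset_of_disjoint.1 (hV i).2.isPreconnected) U W hU hW hi
    (by rw [hUW.inter_eq, inter_empty]) with h | h
  · left
    intro x hx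
    rcases huv hx with h' | h'
    · exact h'
    · exact absurd (hWv ⟨hx, h'⟩) (disjoint_left.1 hUW (h (mem_iInter.1 hx i)))
  · right
    intro x hx
    rcases huv hx with h' | h'
    · exact absurd (h (mem_iInter.1 hx i)) (disjoint_left.1 hUW (hUu ⟨hx, h'⟩))
    · exact h'

/-! ### Horseshoes and indecomposability. -/

/-- Two order-connected sets covering an interval containing two consecutive intervals: one of
them contains one of the two intervals. -/
theorem Icc_subset_or_of_cover {β : Type*} [LinearOrder β] {a b c d : β} {A B : Set β}
    (hA : A.OrdConnected) (hB : B.OrdConnected) (hab : a ≤ b) (hbc : b ≤ c) (hcd : c ≤ d)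
    (h : Icc a d ⊆ A ∪ B) :
    (Icc a b ⊆ A ∨ Icc c d ⊆ A) ∨ (Icc a b ⊆ B ∨ Icc c d ⊆ B) := by
  have key : ∀ A B : Set β, A.OrdConnected → B.OrdConnected → Icc a d ⊆ A ∪ B → a ∈ A →
      Icc a b ⊆ A ∨ Icc c d ⊆ B := by
    intro A B hA hB h ha
    by_cases hb : b ∈ A
    · exact Or.inl (hA.out ha hb)
    · right
      intro t ht
      rcases h ⟨hab.trans (hbc.trans ht.1), ht.2⟩ with h' | h'
      · exact absurd (hA.out ha h' ⟨hab, hbc.trans ht.1⟩) hb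
      · exact h'
  rcases h ⟨le_rfl, hab.trans (hbc.trans hcd)⟩ with ha | ha
  · rcases key A B hA hB h ha with h | h
    · exact Or.inl (Or.inl h)
    · exact Or.inr (Or.inr h)
  · rcases key B A hB hA (by rwa [union_comm]) ha with h | h
    · exact Or.inr (Or.inl h)
    · exact Or.inl (Or.inr h)

/-- If a continuum `S` carries maps `ξ k` to a linear order, all of them onto `[a, d]`, such that
every subcontinuum mapped by `ξ (k + 1)` onto one of `[a, b]`, `[c, d]` is mapped by `ξ k` onto
`[a, d]`, then `S` contains an indecomposable continuum. -/
theorem exists_isIndecomposable_of_horseshoe {α β : Type*} [TopologicalSpace α] [T2Space α]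
    [LinearOrder β] [TopologicalSpace β] [OrderClosedTopology β] {S : Set α} (hS : IsContinuum S)
    (ξ : ℕ → α → β) (hξ : ∀ k, Continuous (ξ k)) {a b c d : β} (hab : a < b) (hbc : b ≤ c)
    (hcd : c < d) (hcov : ∀ k, Icc a d ⊆ ξ k '' S)
    (hstep : ∀ A ⊆ S, IsContinuum A → ∀ k,
      (Icc a b ⊆ ξ (k + 1) '' A ∨ Icc c d ⊆ ξ (k + 1) '' A) → Icc a d ⊆ ξ k '' A) :
    ∃ K ⊆ S, IsIndecomposable K := by
  -- Compactness passes the covering condition to intersections of chains, so Zorn's lemma gives a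
  -- minimal member.
  let F : Set (Set α) := {H | H ⊆ S ∧ IsContinuum H ∧ ∀ k, Icc a d ⊆ ξ k '' H}
  obtain ⟨K, hKS, hK⟩ := zorn_superset_nonempty F (by
    intro C hCF hC hne
    have : Nonempty C := hne.to_subtype
    have hdir : Directed (· ⊇ ·) (fun H : C => (H : Set α)) := by
      intro A B
      rcases hC.total A.2 B.2 with h | h
      · exact ⟨A, subset_rfl, h⟩
      · exact ⟨B, h, subset_rfl⟩
    refine ⟨⋂ H : C, (H : Set α), ⟨?_, isContinuum_iInter hdir fun H => (hCF H.2).2.1, ?_⟩,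
      fun s hs => iInter_subset (fun H : C => (H : Set α)) ⟨s, hs⟩⟩
    · exact (iInter_subset _ (Classical.arbitrary C)).trans (hCF (Classical.arbitrary C).2).1
    · intro k r hr
      have hcl : IsClosed (ξ k ⁻¹' {r}) := isClosed_singleton.preimage (hξ k)
      obtain ⟨x, hx⟩ := IsCompact.nonempty_iInter_of_directed_nonempty_isCompact_isClosed
        (fun H : C => (H : Set α) ∩ ξ k ⁻¹' {r}) (by
          intro A B
          obtain ⟨D, h1, h2⟩ := hdir A B
          exact ⟨D, inter_subset_inter_left _ h1, inter_subset_inter_left _ h2⟩)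
        (fun H => by
          obtain ⟨x, hx, hxr⟩ := (hCF H.2).2.2 k hr
          exact ⟨x, hx, hxr⟩)
        (fun H => (hCF H.2).2.1.1.inter_right hcl)
        (fun H => (hCF H.2).2.1.1.isClosed.inter hcl)
      rw [mem_iInter] at hx
      exact ⟨x, mem_iInter.2 fun H => (hx H).1, (hx (Classical.arbitrary C)).2⟩) S
    ⟨subset_rfl, hS, hcov⟩
  obtain ⟨⟨-, hKc, hKcov⟩, hmin⟩ := hK
  refine ⟨K, hKS, hKc, ?_, ?_⟩
  · obtain ⟨x, hx, hxa⟩ := hKcov 0 ⟨le_rfl, (hab.trans_le (hbc.trans hcd.le)).le⟩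
    obtain ⟨y, hy, hyd⟩ := hKcov 0 ⟨(hab.trans_le (hbc.trans hcd.le)).le, le_rfl⟩
    refine ⟨x, hx, y, hy, fun h => ?_⟩
    rw [h, hyd] at hxa
    exact absurd hxa (hab.trans_le (hbc.trans hcd.le)).ne'
  · intro A B hA hB hAB
    have hAK : A ⊆ K := hAB ▸ subset_union_left
    have hBK : B ⊆ K := hAB ▸ subset_union_right
    have hor : ∀ A, IsContinuum A → ∀ k, (ξ k '' A).OrdConnected := fun A hA k =>
      (hA.2.isPreconnected.image _ (hξ k).continuousOn).ordConnected
    let good : Set α → ℕ → Prop := fun A k => Icc a b ⊆ ξ k '' A ∨ Icc c d ⊆ ξ k '' A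
    have hgood : ∀ k, good A k ∨ good B k := fun k =>
      Icc_subset_or_of_cover (hor A hA k) (hor B hB k) hab.le hbc hcd.le
        (by rw [← image_union, hAB]; exact hKcov k)
    -- Covering one of the two short intervals at some index gives all of `[a, d]` at every smaller
    -- index; minimality of `K` then forces `A = K`.
    have fin : ∀ A ⊆ K, IsContinuum A → (∀ n, ∃ k, n ≤ k ∧ good A k) → A = K := by
      intro A hAK hA hio
      have down : ∀ j k, good A (k + j + 1) → Icc a d ⊆ ξ k '' A := by
        intro j
        induction j with
        | zero => exact fun k h => hstep A (hAK.trans hKS) hA k h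
        | succ j ih =>
          intro k h
          refine ih k (Or.inl ((Icc_subset_Icc_right (hbc.trans hcd.le)).trans ?_))
          exact hstep A (hAK.trans hKS) hA _ h
      refine hAK.antisymm (hmin ⟨hAK.trans hKS, hA, fun k => ?_⟩ hAK)
      obtain ⟨m, hm, hg⟩ := hio (k + 1)
      obtain ⟨j, rfl⟩ := Nat.exists_eq_add_of_le hm
      exact down j k (by rwa [show k + j + 1 = k + 1 + j by omega])
    by_cases hio : ∀ n, ∃ k, n ≤ k ∧ good A k
    · exact Or.inl (fin A hAK hA hio)
    · right
      push Not at hio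
      obtain ⟨n, hn⟩ := hio
      exact fin B hBK hB fun m => ⟨max m n, le_max_left _ _,
        (hgood _).resolve_left (hn _ (le_max_right _ _))⟩

/-! ### Interval values, images of continua, and the inverse limit. -/

variable {f : I → NonemptyCompacts I}

theorem mem_image_iff {A : Set I} {y : I} : y ∈ SetValued.image f A ↔ ∃ x ∈ A, y ∈ f x := by
  simp [SetValued.image]

theorem image_mono {A B : Set I} (h : A ⊆ B) : SetValued.image f A ⊆ SetValued.image f B :=
  biUnion_subset_biUnion_left h

theorem iterate_image_mono {A B : Set I} (h : A ⊆ B) (n : ℕ) :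
    (SetValued.image f)^[n] A ⊆ (SetValued.image f)^[n] B := by
  induction n with
  | zero => exact h
  | succ n ih =>
    rw [Function.iterate_succ_apply', Function.iterate_succ_apply']
    exact image_mono ih

/-- An upper semicontinuous function with the intermediate value property has interval values. -/
theorem ordConnected_of_hasIVP (husc : IsUSC f) (hivp : HasIVP f) (x : I) :
    (f x : Set I).OrdConnected := by
  refine ⟨fun y₁ h₁ y₂ h₂ y hy => ?_⟩
  by_contra hyf
  have hy1 : y₁ < y := lt_of_le_of_ne hy.1 fun h => hyf (h ▸ h₁)
  have hy2 : y < y₂ := lt_of_le_of_ne hy.2 fun h => hyf (h ▸ h₂)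
  -- Near `x` no value equals `y`. A value at a nearby `z` lies on one side of `y`, and one of `y₁`,
  -- `y₂` lies on the other, so the intermediate value property is violated between `z` and `x`.
  have hV := husc.forall_isOpen x {y}ᶜ isOpen_compl_singleton
    (fun z hz hzy => hyf (by rw [← mem_singleton_iff.1 hzy]; exact hz))
  obtain ⟨p, q, hpq, hnhd, hsub⟩ := exists_Icc_mem_subset_of_mem_nhds hV
  have hne : (𝓝[≠] x).NeBot := inferInstance
  obtain ⟨z, hz, hzx⟩ := (hne.nonempty_of_mem (inter_mem_nhdsWithin _ hnhd))
  have avoid : ∀ x' ∈ uIoo z x, y ∉ f x' := by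
    intro x' hx' hy'
    exact hsub (ordConnected_Icc.uIcc_subset hzx hpq (uIoo_subset_uIcc_self hx')) hy' rfl
  obtain ⟨w, hw⟩ := (f z).nonempty
  have hwy : w ≠ y := fun h => hsub hzx hw h
  rcases lt_or_gt_of_ne hwy with h | h
  · obtain ⟨x', hx', hy'⟩ := hivp z x hz w hw y₂ h₂ y (by
      rw [uIoo_of_lt (h.trans hy2)]; exact ⟨h, hy2⟩)
    exact avoid x' hx' hy'
  · obtain ⟨x', hx', hy'⟩ := hivp z x hz w hw y₁ h₁ y (by
      rw [uIoo_of_gt (hy1.trans h)]; exact ⟨hy1, h⟩)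
    exact avoid x' hx' hy'

theorem isClosed_graph (husc : IsUSC f) : IsClosed (graph f) := by
  refine IsSeqClosed.isClosed fun p p₀ hp hlim => ?_
  rw [Prod.tendsto_iff] at hlim
  exact (husc.upperHemicontinuousAt p₀.1).mem_of_tendsto (f p₀.1).isCompact.isClosed hlim.1
    (Eventually.of_forall hp).frequently hlim.2

theorem isCompact_image (hG : IsClosed (graph f)) {A : Set I} (hA : IsCompact A) :
    IsCompact (SetValued.image f A) := by
  have : SetValued.image f A = Prod.snd '' (graph f ∩ A ×ˢ univ) := by
    ext y
    simp [mem_image_iff, graph, and_comm]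
  rw [this]
  exact ((hA.prod isCompact_univ).inter_left hG).image continuous_snd

theorem isPreconnected_restrict_graph (hG : IsClosed (graph f))
    (hI : ∀ x, (f x : Set I).OrdConnected) {A : Set I} (hA : IsCompact A)
    (hA' : IsPreconnected A) : IsPreconnected (graph f ∩ A ×ˢ univ) := by
  refine isPreconnected_of_fibers ((hA.prod isCompact_univ).inter_left hG) hA'
    (fun p hp => hp.2.1) (fun c hc => ?_) (fun c hc => ?_)
  · obtain ⟨y, hy⟩ := (f c).nonempty
    exact ⟨y, hy, hc, mem_univ _⟩
  · have : {b | (c, b) ∈ graph f ∩ A ×ˢ univ} = (f c : Set I) := by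
      ext b; simp [graph, hc]
    rw [this]
    exact (hI c).isPreconnected

theorem isPreconnected_image (hG : IsClosed (graph f)) (hI : ∀ x, (f x : Set I).OrdConnected)
    {A : Set I} (hA : IsCompact A) (hA' : IsPreconnected A) :
    IsPreconnected (SetValued.image f A) := by
  have : SetValued.image f A = Prod.snd '' (graph f ∩ A ×ˢ univ) := by
    ext y
    simp [mem_image_iff, graph, and_comm]
  rw [this]
  exact (isPreconnected_restrict_graph hG hI hA hA').image _ continuous_snd.continuousOn

/-- This replaces continuity: an image of an interval contains everything between any two of its
values. -/
theorem IsContinuum.setValued_image (hG : IsClosed (graph f))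
    (hI : ∀ x, (f x : Set I).OrdConnected) {A : Set I} (hA : IsContinuum A) :
    IsContinuum (SetValued.image f A) := by
  refine ⟨isCompact_image hG hA.1, ?_, isPreconnected_image hG hI hA.1 hA.2.isPreconnected⟩
  obtain ⟨x, hx⟩ := hA.2.nonempty
  obtain ⟨y, hy⟩ := (f x).nonempty
  exact ⟨y, mem_image_iff.2 ⟨x, hx, hy⟩⟩

theorem IsContinuum.iterate_image (hG : IsClosed (graph f))
    (hI : ∀ x, (f x : Set I).OrdConnected) {A : Set I} (hA : IsContinuum A) (n : ℕ) :
    IsContinuum ((SetValued.image f)^[n] A) := by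
  induction n with
  | zero => exact hA
  | succ n ih =>
    rw [Function.iterate_succ_apply']
    exact ih.setValued_image hG hI

theorem isContinuum_Icc {a b : I} (h : a ≤ b) : IsContinuum (Icc a b) :=
  ⟨isCompact_Icc, nonempty_Icc.2 h, isPreconnected_Icc⟩

/-- Prepend a term to a sequence. -/
def cons {α : Type*} (a : α) (x : ℕ → α) : ℕ → α
  | 0 => a
  | n + 1 => x n

@[simp] theorem cons_zero {α : Type*} (a : α) (x : ℕ → α) : cons a x 0 = a := rfl

@[simp] theorem cons_succ {α : Type*} (a : α) (x : ℕ → α) (n : ℕ) : cons a x (n + 1) = x n := rfl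

theorem continuous_cons {α : Type*} [TopologicalSpace α] :
    Continuous fun p : (ℕ → α) × α => cons p.2 p.1 := by
  refine continuous_pi fun n => ?_
  cases n with
  | zero => exact continuous_snd
  | succ n => exact (continuous_apply n).comp continuous_fst

/-- Prepending terms related by `f` preserves continua of sequences. -/
theorem isContinuum_cons (hG : IsClosed (graph f)) (hI : ∀ x, (f x : Set I).OrdConnected)
    {C : Set (ℕ → I)} (hC : IsContinuum C) :
    IsContinuum {x : ℕ → I | x 0 ∈ f (x 1) ∧ (fun n => x (n + 1)) ∈ C} := by
  let E : Set ((ℕ → I) × I) := {p | p.1 ∈ C ∧ p.2 ∈ f (p.1 0)}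
  have hE : IsCompact E := by
    have : E = (fun p : (ℕ → I) × I => (p.1 0, p.2)) ⁻¹' graph f ∩ C ×ˢ univ := by
      ext p; simp [E, graph, and_comm]
    rw [this]
    exact (hC.1.prod isCompact_univ).inter_left (hG.preimage (by fun_prop))
  have hEc : IsConnected E := by
    refine ⟨?_, isPreconnected_of_fibers hE hC.2.isPreconnected (fun p hp => hp.1)
      (fun c hc => ?_) (fun c hc => ?_)⟩
    · obtain ⟨x, hx⟩ := hC.2.nonempty
      obtain ⟨y, hy⟩ := (f (x 0)).nonempty
      exact ⟨(x, y), hx, hy⟩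
    · obtain ⟨y, hy⟩ := (f (c 0)).nonempty
      exact ⟨y, hc, hy⟩
    · have : {b | (c, b) ∈ E} = (f (c 0) : Set I) := by
        ext b; simp [E, hc]
      rw [this]
      exact (hI _).isPreconnected
  have heq : {x : ℕ → I | x 0 ∈ f (x 1) ∧ (fun n => x (n + 1)) ∈ C} =
      (fun p : (ℕ → I) × I => cons p.2 p.1) '' E := by
    ext x
    constructor
    · rintro ⟨h1, h2⟩
      refine ⟨(fun n => x (n + 1), x 0), ⟨h2, h1⟩, ?_⟩
      funext n
      cases n <;> rfl
    · rintro ⟨⟨y, a⟩, ⟨h1, h2⟩, rfl⟩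
      exact ⟨h2, h1⟩
  rw [heq]
  exact IsContinuum.image ⟨hE, hEc⟩ continuous_cons.continuousOn

/-- Imposing only the first `N` relations amounts to prepending `N` terms to arbitrary sequences.
This yields continua that decrease to the inverse limit. -/
theorem isContinuum_inverseLimit (hG : IsClosed (graph f))
    (hI : ∀ x, (f x : Set I).OrdConnected) : IsContinuum (inverseLimit f) := by
  let V : ℕ → Set (ℕ → I) := fun N => {x | ∀ i < N, x i ∈ f (x (i + 1))}
  have hV : ∀ N, IsContinuum (V N) := by
    intro N
    induction N with
    | zero =>
      have : V 0 = univ := by ext; simp [V]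
      rw [this]
      exact ⟨isCompact_univ, isConnected_univ⟩
    | succ N ih =>
      convert isContinuum_cons hG hI ih using 1
      ext x
      refine ⟨fun h => ⟨h 0 (Nat.succ_pos N), fun i hi => h (i + 1) (Nat.succ_lt_succ hi)⟩, ?_⟩
      rintro ⟨h0, h1⟩ i hi
      cases i with
      | zero => exact h0
      | succ i => exact h1 i (Nat.lt_of_succ_lt_succ hi)
  have hanti : Antitone V := fun M N h x hx i hi => hx i (hi.trans_le h)
  have : inverseLimit f = ⋂ N, V N := by
    ext x
    simp only [inverseLimit, mem_iInter]
    exact ⟨fun h N i _ => h i, fun h i => h (i + 1) i (Nat.lt_succ_self i)⟩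
  rw [this]
  exact isContinuum_iInter hanti.directed_ge hV

/-! ### Odd cycles produce horseshoes. -/

/-- A set-valued dynamical system on the interval with a nonconstant cycle of odd length has a
horseshoe. -/
theorem exists_horseshoe_of_odd_cycle {T : Set I → Set I} (hmono : Monotone T)
    (hcont : ∀ A, IsContinuum A → IsContinuum (T A)) {y : ℕ → I}
    (hy : ∀ A i, y i ∈ A → y (i + 1) ∈ T A) {m : ℕ} (hm : Odd m) (hper : ∀ i, y (m + i) = y i)
    (hne : ∃ i, y i ≠ y 0) :
    ∃ (N : ℕ) (a b c d : I), a ∈ range y ∧ d ∈ range y ∧ a < b ∧ b ≤ c ∧ c < d ∧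
      Icc a d ⊆ T^[N] (Icc a b) ∧ Icc a d ⊆ T^[N] (Icc c d) := by
  have hm0 : 0 < m := hm.pos
  have hper' : ∀ n i, y (n * m + i) = y i := by
    intro n
    induction n with
    | zero => intro i; simp
    | succ n ih => intro i; rw [show (n + 1) * m + i = m + (n * m + i) by ring, hper, ih]
  have hreach : ∀ i j, ∃ n, y (i + n) = y j := fun i j =>
    ⟨i * (m - 1) + j, by
      obtain ⟨q, rfl⟩ : ∃ q, m = q + 1 := ⟨m - 1, by omega⟩
      rw [← hper' i j]
      congr 1
      simp only [Nat.add_sub_cancel]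
      ring⟩
  have hfin : (range y).Finite := by
    refine ((finite_Iio m).image y).subset ?_
    rintro _ ⟨i, rfl⟩
    refine ⟨i % m, Nat.mod_lt _ hm0, ?_⟩
    conv_rhs => rw [← Nat.div_add_mod' i m]
    rw [hper']
  have hTit : ∀ n, Monotone T^[n] := fun n => hmono.iterate n
  have hcit : ∀ n A, IsContinuum A → IsContinuum (T^[n] A) := by
    intro n
    induction n with
    | zero => exact fun A h => h
    | succ n ih => exact fun A h => ih _ (hcont A h)
  have hyit : ∀ n A i, y i ∈ A → y (i + n) ∈ T^[n] A := by
    intro n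
    induction n with
    | zero => exact fun A i h => h
    | succ n ih =>
      intro A i h
      rw [show i + (n + 1) = i + 1 + n by ring]
      exact ih _ _ (hy A i h)
  have hoc : ∀ A : Set I, IsContinuum A → A.OrdConnected := fun A h => h.2.isPreconnected.ordConnected
  -- the rightmost point that moves right
  obtain ⟨i₀, hi₀, hmax⟩ : ∃ i₀, y i₀ < y (i₀ + 1) ∧ ∀ i, y i < y (i + 1) → y i ≤ y i₀ := by
    have hS : (y '' {i | y i < y (i + 1)}).Nonempty := by
      by_contra hcon
      have hanti : Antitone y := antitone_nat_of_succ_le fun i => by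
        by_contra h
        exact hcon ⟨y i, i, not_le.1 h, rfl⟩
      obtain ⟨i, hi⟩ := hne
      refine hi (le_antisymm (hanti (Nat.zero_le i)) ?_)
      rw [← hper' i 0]
      exact hanti (by nlinarith)
    obtain ⟨_, ⟨i, hi, rfl⟩, hi'⟩ := exists_max_image _ id (hfin.subset (image_subset_range _ _)) hS
    exact ⟨i, hi, fun j hj => hi' _ ⟨j, hj, rfl⟩⟩
  obtain ⟨k₀, hq₀, hmin⟩ : ∃ k₀, y i₀ < y k₀ ∧ ∀ r, y i₀ < y r → y k₀ ≤ y r := by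
    obtain ⟨_, ⟨i, hi, rfl⟩, hi'⟩ := exists_min_image (y '' {i | y i₀ < y i}) id
      (hfin.subset (image_subset_range _ _)) ⟨_, i₀ + 1, hi₀, rfl⟩
    exact ⟨i, hi, fun j hj => hi' _ ⟨j, hj, rfl⟩⟩
  -- `y k` is the cycle point just right of `y i₀`. One value may have several successors, so `k` is
  -- an index at which that point jumps back to the left; without one the orbit would stay at that
  -- point forever.
  obtain ⟨k, hq, hk', hright⟩ : ∃ k, y i₀ < y k ∧ y (k + 1) ≤ y i₀ ∧
      ∀ i, ¬ y i ≤ y i₀ → y k ≤ y i := by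
    by_contra! hcon
    have hstay : ∀ n, y (k₀ + n) = y k₀ := by
      intro n
      induction n with
      | zero => rfl
      | succ n ih =>
        have h1 : y i₀ < y (k₀ + n + 1) := by
          by_contra h
          obtain ⟨i, hi, hi'⟩ := hcon (k₀ + n) (ih ▸ hq₀) (not_lt.1 h)
          exact absurd (hmin i hi) (not_le.2 (ih ▸ hi'))
        refine le_antisymm ?_ (hmin _ h1)
        by_contra h
        have := hmax (k₀ + n) (by rw [ih]; exact not_le.1 h)
        rw [ih] at this
        exact absurd hq₀ (not_lt.2 this)
    obtain ⟨n, hn⟩ := hreach k₀ i₀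
    rw [hstay] at hn
    exact hq₀.ne' hn
  have hi₀1 : y k ≤ y (i₀ + 1) := hright _ (not_le.2 hi₀)
  have hcover : ∀ A, IsContinuum A → ∀ i j, y i ∈ A → y j ∈ A → y (i + 1) ≤ y i₀ →
      y k ≤ y (j + 1) → Icc (y i₀) (y k) ⊆ T A := fun A hA i j hi hj h1 h2 =>
    (Icc_subset_Icc h1 h2).trans ((hoc _ (hcont A hA)).out (hy A i hi) (hy A j hj))
  have hIc : IsContinuum (Icc (y i₀) (y k)) := isContinuum_Icc hq.le
  have hII : Icc (y i₀) (y k) ⊆ T (Icc (y i₀) (y k)) :=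
    hcover _ hIc k i₀ ⟨hq.le, le_rfl⟩ ⟨le_rfl, hq.le⟩ hk' hi₀1
  have hinc : Monotone fun n => T^[n] (Icc (y i₀) (y k)) := by
    refine monotone_nat_of_le_succ fun n => ?_
    rw [Function.iterate_succ_apply]
    exact hTit n hII
  -- The gap `[y i₀, y k]` covers itself, so its iterates increase and from some time on contain any
  -- given cycle point.
  have hall : ∀ J s, Icc (y i₀) (y k) ⊆ T^[s] J → ∀ j, ∃ n, ∀ N, n ≤ N → y j ∈ T^[N] J := by
    intro J s hs j
    obtain ⟨n, hn⟩ := hreach i₀ j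
    refine ⟨n + s, fun N hN => ?_⟩
    obtain ⟨t, rfl⟩ := Nat.exists_eq_add_of_le hN
    rw [show n + s + t = (n + t) + s by ring, Function.iterate_add_apply]
    refine hTit _ hs (hinc (Nat.le_add_right n t) ?_)
    rw [← hn]
    exact hyit n _ _ ⟨le_rfl, hq.le⟩
  -- Two nonoverlapping intervals whose outer endpoints are cycle points form a horseshoe once each
  -- of them covers the gap at some time.
  have close : ∀ ja jd b c s s', y ja < b → b ≤ c → c < y jd →
      Icc (y i₀) (y k) ⊆ T^[s] (Icc (y ja) b) → Icc (y i₀) (y k) ⊆ T^[s'] (Icc c (y jd)) →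
      ∃ (N : ℕ) (a b c d : I), a ∈ range y ∧ d ∈ range y ∧ a < b ∧ b ≤ c ∧ c < d ∧
        Icc a d ⊆ T^[N] (Icc a b) ∧ Icc a d ⊆ T^[N] (Icc c d) := by
    intro ja jd b c s s' h1 h2 h3 h4 h5
    obtain ⟨n1, hn1⟩ := hall _ _ h4 ja
    obtain ⟨n2, hn2⟩ := hall _ _ h4 jd
    obtain ⟨n3, hn3⟩ := hall _ _ h5 ja
    obtain ⟨n4, hn4⟩ := hall _ _ h5 jd
    refine ⟨n1 + n2 + n3 + n4, y ja, b, c, y jd, ⟨ja, rfl⟩, ⟨jd, rfl⟩, h1, h2, h3, ?_, ?_⟩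
    · exact (hoc _ (hcit _ _ (isContinuum_Icc h1.le))).out (hn1 _ (by omega)) (hn2 _ (by omega))
    · exact (hoc _ (hcit _ _ (isContinuum_Icc h3.le))).out (hn3 _ (by omega)) (hn4 _ (by omega))
  -- If every continuum through a single cycle point covers the gap in one step, the two halves of
  -- the gap serve: each has a cycle point as endpoint and so reaches that point.
  have hair : ∀ l, (∀ A, IsContinuum A → y l ∈ A → Icc (y i₀) (y k) ⊆ T A) →
      ∃ (N : ℕ) (a b c d : I), a ∈ range y ∧ d ∈ range y ∧ a < b ∧ b ≤ c ∧ c < d ∧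
        Icc a d ⊆ T^[N] (Icc a b) ∧ Icc a d ⊆ T^[N] (Icc c d) := by
    intro l hl
    have hs : ∀ J, IsContinuum J → ∀ j, y j ∈ J → ∃ s, Icc (y i₀) (y k) ⊆ T^[s] J := by
      intro J hJ j hj
      obtain ⟨n, hn⟩ := hreach j l
      refine ⟨n + 1, ?_⟩
      rw [Function.iterate_succ_apply']
      exact hl _ (hcit n J hJ) (hn ▸ hyit n J j hj)
    obtain ⟨e, he1, he2⟩ := exists_between hq
    obtain ⟨s, hs1⟩ := hs _ (isContinuum_Icc he1.le) i₀ ⟨le_rfl, he1.le⟩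
    obtain ⟨s', hs2⟩ := hs _ (isContinuum_Icc he2.le) k ⟨he2.le, le_rfl⟩
    exact close _ _ _ _ s s' he1 le_rfl he2 hs1 hs2
  -- An orbit of odd length cannot change sides of the gap at every step.
  obtain ⟨i, hi⟩ : ∃ i, (y i ≤ y i₀ ↔ y (i + 1) ≤ y i₀) := by
    by_contra hcon
    rw [not_exists] at hcon
    obtain ⟨t, rfl⟩ := hm
    have halt : ∀ n, y (2 * n + 0) ≤ y i₀ ↔ y 0 ≤ y i₀ := by
      intro n
      induction n with
      | zero => rfl
      | succ n ih =>
        have h1 := hcon (2 * n + 0)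
        have h2 := hcon (2 * n + 0 + 1)
        rw [show 2 * (n + 1) + 0 = 2 * n + 0 + 1 + 1 by ring]
        tauto
    have h1 := hcon (2 * t + 0)
    have h2 := halt t
    have h3 := hper 0
    simp only [add_zero] at h1 h2 h3
    rw [h3] at h1
    tauto
  by_cases hil : y i ≤ y i₀
  · have hi1 := hi.1 hil
    rcases hil.lt_or_eq with h | h
    -- `y i` stays on the left while `y i₀` jumps across, so `[y i, y i₀]` covers the gap; the gap
    -- itself is the second interval. If `y i = y i₀`, one point has successors on both sides.
    · exact close i k (y i₀) (y i₀) 1 0 h le_rfl hq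
        (hcover _ (isContinuum_Icc h.le) i i₀ ⟨le_rfl, h.le⟩ ⟨h.le, le_rfl⟩ hi1 hi₀1) subset_rfl
    · exact hair i fun A hA hA' => hcover A hA i i₀ hA' (h ▸ hA') hi1 hi₀1
  · have hi1 := hright _ (fun h => hil (hi.2 h))
    rcases (hright _ hil).lt_or_eq with h | h
    · exact close i₀ i (y k) (y k) 0 1 hq le_rfl h subset_rfl
        (hcover _ (isContinuum_Icc h.le) k i ⟨le_rfl, h.le⟩ ⟨h.le, le_rfl⟩ hk'
          hi1)
    · exact hair i fun A hA hA' => hcover A hA k i (by rw [h]; exact hA') hA' hk' hi1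

theorem IsOrbit.mem_iterate {x : ℕ → I} (hx : IsOrbit f x) {A : Set I} {i : ℕ} (hi : x i ∈ A)
    (n : ℕ) : x (i + n) ∈ (SetValued.image f)^[n] A := by
  induction n with
  | zero => exact hi
  | succ n ih =>
    rw [Function.iterate_succ_apply']
    exact mem_image_iff.2 ⟨_, ih, hx (i + n)⟩

/-- Every point of a periodic orbit has a full backward orbit. -/
theorem IsOrbit.mem_eval_inverseLimit {x : ℕ → I} (hx : IsOrbit f x) {p : ℕ} (hp : 0 < p)
    (hper : ∀ i, x (p + i) = x i) (i : ℕ) : x i ∈ (fun w : ℕ → I => w 0) '' inverseLimit f := by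
  obtain ⟨q, rfl⟩ : ∃ q, p = q + 1 := ⟨p - 1, by omega⟩
  -- Modulo the period `q + 1`, one step back is `q` steps forward.
  refine ⟨fun j => x (i + j * q), fun j => ?_, by simp⟩
  have := hx (i + (j + 1) * q)
  rwa [show i + (j + 1) * q + 1 = q + 1 + (i + j * q) by ring, hper] at this

/-- A cycle whose period is not a power of two yields a horseshoe for an iterate. -/
theorem exists_horseshoe (hG : IsClosed (graph f)) (hI : ∀ x, (f x : Set I).OrdConnected)
    {p : ℕ} (hp : HasCycleOfPeriod f p) (hp2 : ¬ ∃ k : ℕ, p = 2 ^ k) :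
    ∃ (N : ℕ) (a b c d : I), a ∈ (fun w : ℕ → I => w 0) '' inverseLimit f ∧
      d ∈ (fun w : ℕ → I => w 0) '' inverseLimit f ∧ a < b ∧ b ≤ c ∧ c < d ∧
      Icc a d ⊆ (SetValued.image f)^[N] (Icc a b) ∧
      Icc a d ⊆ (SetValued.image f)^[N] (Icc c d) := by
  obtain ⟨x, hx, ⟨hp0, hper⟩, hleast⟩ := hp
  obtain ⟨k, m, hm, rfl⟩ := Nat.exists_eq_two_pow_mul_odd hp0.ne'
  -- Otherwise `2 ^ k` would already be a period, which forces `m = 1`.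
  obtain ⟨r, hr⟩ : ∃ r, x (r + 2 ^ k) ≠ x r := by
    by_contra! hcon
    have h1 : 2 ^ k * m ≤ 2 ^ k := hleast ⟨by positivity, fun i => by rw [add_comm, hcon]⟩
    have h2 : m = 1 := by
      have := hm.pos
      have h3 : m ≤ 1 := by
        by_contra h
        have : 2 ^ k * 2 ≤ 2 ^ k * m := Nat.mul_le_mul_left _ (by omega)
        have : 0 < 2 ^ k := by positivity
        omega
      omega
    exact hp2 ⟨k, by rw [h2, mul_one]⟩
  obtain ⟨N, a, b, c, d, ⟨i, hi⟩, ⟨j, hj⟩, hab, hbc, hcd, h1, h2⟩ :=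
    exists_horseshoe_of_odd_cycle (T := (SetValued.image f)^[2 ^ k])
      (y := fun i => x (r + 2 ^ k * i)) (fun A B h => iterate_image_mono h _)
      (fun A hA => hA.iterate_image hG hI _) (fun A i hi => by
        rw [show r + 2 ^ k * (i + 1) = r + 2 ^ k * i + 2 ^ k by ring]
        exact hx.mem_iterate hi _) hm (fun i => by
        rw [show r + 2 ^ k * (m + i) = 2 ^ k * m + (r + 2 ^ k * i) by ring, hper])
      ⟨1, by simpa using hr⟩
  rw [← Function.iterate_mul] at h1 h2
  exact ⟨_, a, b, c, d, hi ▸ hx.mem_eval_inverseLimit hp0 hper _,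
    hj ▸ hx.mem_eval_inverseLimit hp0 hper _, hab, hbc, hcd, h1, h2⟩

/-! ### Crossing continua, by winding numbers. -/

/-- Both arguments lie in `(-π/2, π/2)`, so their difference needs no reduction modulo `2π`. -/
theorem arg_div_of_re_pos {x y : ℂ} (hx : 0 < x.re) (hy : 0 < y.re) :
    (x / y).arg = x.arg - y.arg := by
  have hx0 : x ≠ 0 := fun h => by simp [h] at hx
  have hy0 : y ≠ 0 := fun h => by simp [h] at hy
  have h1 := abs_lt.1 (Complex.abs_arg_lt_pi_div_two_iff.2 (Or.inl hx))
  have h2 := abs_lt.1 (Complex.abs_arg_lt_pi_div_two_iff.2 (Or.inl hy))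
  have h3 := Complex.arg_div_coe_angle hx0 hy0
  rw [← Real.Angle.coe_sub] at h3
  rw [← Complex.arg_coe_angle_toReal_eq_arg, h3]
  exact Real.Angle.toReal_coe_eq_self_iff.2 ⟨by linarith, by linarith⟩

/-- A nonvanishing complex function on `Z × [0,1]` that moves from the lower to the upper half
plane cannot do so both through the left half plane and through the right half plane. -/
theorem false_of_winding {Z : Type*} [TopologicalSpace Z] [CompactSpace Z] [ConnectedSpace Z]
    (w : C(I × Z, ℂ)) (hw : ∀ x, w x ≠ 0) (h0 : ∀ z, (w (0, z)).im < 0)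
    (h1 : ∀ z, 0 < (w (1, z)).im) {p q : Z} (hp : ∀ s, (w (s, p)).re < 0)
    (hq : ∀ s, 0 < (w (s, q)).re) : False := by
  obtain ⟨m, hm0, hm⟩ : ∃ m : ℝ, 0 < m ∧ ∀ x, m ≤ ‖w x‖ := by
    have : Nonempty (I × Z) := ⟨(0, p)⟩
    obtain ⟨x, -, hx⟩ := isCompact_univ.exists_isMinOn univ_nonempty
      (w.continuous.norm.continuousOn (s := univ))
    exact ⟨‖w x‖, norm_pos_iff.2 (hw x), fun y => hx (mem_univ y)⟩
  obtain ⟨δ, hδ0, hδ⟩ := Metric.uniformContinuous_iff.1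
    (CompactSpace.uniformContinuous_of_continuous w.curry.continuous) m hm0
  obtain ⟨N, hN⟩ := exists_nat_one_div_lt hδ0
  have hN0 : (0 : ℝ) < (N : ℝ) + 1 := by positivity
  -- The partition is so fine that consecutive values of `w` have ratio within 1 of 1, uniformly in
  -- `z`; the principal argument of each ratio is then continuous in `z`.
  let s : ℕ → I := fun j => projIcc 0 1 zero_le_one ((j : ℝ) / (N + 1))
  have hs0 : s 0 = 0 := by simp [s]
  have hsN : s (N + 1) = 1 := by
    have : ((N + 1 : ℕ) : ℝ) / ((N : ℝ) + 1) = 1 := by push_cast; exact div_self hN0.ne'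
    simp only [s, this]
    exact projIcc_of_right_le (zero_le_one (α := ℝ)) le_rfl
  let r : ℕ → Z → ℂ := fun j z => w (s (j + 1), z) / w (s j, z)
  have hr : ∀ j z, 0 < (r j z).re := by
    intro j z
    have hd : dist (s (j + 1)) (s j) < δ := by
      refine lt_of_le_of_lt ?_ hN
      rw [Subtype.dist_eq, Real.dist_eq]
      refine (abs_projIcc_sub_projIcc (a := (0 : ℝ)) (b := 1) zero_le_one).trans (le_of_eq ?_)
      rw [← sub_div]
      push_cast
      rw [add_sub_cancel_left, abs_of_pos (by positivity)]
    have h2 : ‖w (s (j + 1), z) - w (s j, z)‖ < ‖w (s j, z)‖ := by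
      have := (ContinuousMap.dist_apply_le_dist z).trans_lt (hδ hd)
      rw [dist_eq_norm] at this
      exact this.trans_le (hm _)
    have h3 : ‖r j z - 1‖ < 1 := by
      have hne := hw (s j, z)
      have : r j z - 1 = (w (s (j + 1), z) - w (s j, z)) / w (s j, z) := by
        simp only [r]; field_simp
      rw [this, norm_div, div_lt_one (norm_pos_iff.2 hne)]
      exact h2
    have h4 := (abs_lt.1 ((Complex.abs_re_le_norm _).trans_lt h3)).1
    simp only [Complex.sub_re, Complex.one_re] at h4
    linarith
  have hrc : ∀ j, Continuous fun z => (r j z).arg := by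
    intro j
    have hcr : Continuous (r j) :=
      (w.continuous.comp (by fun_prop)).div (w.continuous.comp (by fun_prop)) fun z => hw _
    exact continuous_iff_continuousAt.2 fun z =>
      (Complex.continuousAt_arg (Or.inl (hr j z))).comp hcr.continuousAt
  -- `θ` is the total change of argument along `s ↦ w (s, z)`. The defect `η` is continuous with
  -- values in `2πℤ`, yet it is `0` at `q` and `-2π` at `p`.
  let θ : Z → ℝ := fun z => ∑ j ∈ Finset.range (N + 1), (r j z).arg
  let η : Z → ℝ := fun z => (w (0, z)).arg + θ z - (w (1, z)).arg
  have hη : Continuous η := by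
    refine ((continuous_iff_continuousAt.2 fun z => ?_).add
      (continuous_finsetSum _ fun j _ => hrc j)).sub (continuous_iff_continuousAt.2 fun z => ?_)
    · exact ContinuousAt.comp (f := fun z => w (0, z)) (Complex.continuousAt_arg (Or.inr (h0 z).ne))
        (w.continuous.comp (by fun_prop : Continuous fun z => ((0 : I), z))).continuousAt
    · exact ContinuousAt.comp (f := fun z => w (1, z)) (Complex.continuousAt_arg (Or.inr (h1 z).ne'))
        (w.continuous.comp (by fun_prop : Continuous fun z => ((1 : I), z))).continuousAt
  have hangle : ∀ z, ((η z : ℝ) : Real.Angle) = 0 := by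
    intro z
    have hθ : ((θ z : ℝ) : Real.Angle) = (w (1, z)).arg - (w (0, z)).arg := by
      have : ((θ z : ℝ) : Real.Angle) =
          ∑ j ∈ Finset.range (N + 1), (((r j z).arg : ℝ) : Real.Angle) :=
        map_sum Real.Angle.coeHom _ _
      rw [this, Finset.sum_congr rfl fun j _ => Complex.arg_div_coe_angle (hw _) (hw _),
        Finset.sum_range_sub (fun j => (((w (s j, z)).arg : ℝ) : Real.Angle)), hs0, hsN]
    simp only [η, Real.Angle.coe_sub, Real.Angle.coe_add, hθ]
    abel
  have hηq : η q = 0 := by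
    have : θ q = (w (1, q)).arg - (w (0, q)).arg := by
      simp only [θ]
      rw [Finset.sum_congr rfl fun j _ => arg_div_of_re_pos (hq _) (hq _),
        Finset.sum_range_sub (fun j => (w (s j, q)).arg), hs0, hsN]
    simp only [η, this]
    ring
  have hηp : η p = - (2 * Real.pi) := by
    -- Negation moves the path over `p` away from the cut of `arg`; undoing it costs `π` at each
    -- end, with signs that add up to `-2π`.
    have hp' : ∀ s, 0 < (-w (s, p)).re := fun s => by simpa using hp s
    have : θ p = (-w (1, p)).arg - (-w (0, p)).arg := by
      have : ∀ j, (r j p).arg = (-w (s (j + 1), p)).arg - (-w (s j, p)).arg := fun j => by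
        rw [← arg_div_of_re_pos (hp' _) (hp' _), neg_div_neg_eq]
      simp only [θ]
      rw [Finset.sum_congr rfl fun j _ => this j,
        Finset.sum_range_sub (fun j => (-w (s j, p)).arg), hs0, hsN]
    simp only [η, this, Complex.arg_neg_eq_arg_sub_pi_of_im_pos (h1 p),
      Complex.arg_neg_eq_arg_add_pi_of_im_neg (h0 p)]
    ring
  obtain ⟨z, hz⟩ := intermediate_value_univ p q hη
    (show -Real.pi ∈ Icc (η p) (η q) by
      rw [hηp, hηq]; constructor <;> linarith [Real.pi_pos])
  have := hangle z
  rw [hz, Real.Angle.coe_neg, neg_eq_zero] at this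
  exact Real.Angle.pi_ne_zero this

/-- A closed subset of `Z × [0,1]` that separates `{p} × [0,1]` from `{q} × [0,1]` contains a
continuum joining the bottom to the top. -/
theorem exists_continuum_crossing {Z : Type*} [TopologicalSpace Z] [CompactSpace Z] [T2Space Z]
    [ConnectedSpace Z] {F : Z × I → ℝ} (hF : Continuous F) {p q : Z} (hp : ∀ s, F (p, s) < 0)
    (hq : ∀ s, 0 < F (q, s)) :
    ∃ C ⊆ {x | F x = 0}, IsContinuum C ∧ (∃ z, (z, 0) ∈ C) ∧ ∃ z, (z, 1) ∈ C := by
  have hS : IsClosed {x | F x = 0} := isClosed_eq hF continuous_const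
  have hA : IsClosed {x : Z × I | x.2 = 0} := isClosed_eq continuous_snd continuous_const
  have hB : IsClosed {x : Z × I | x.2 = 1} := isClosed_eq continuous_snd continuous_const
  rcases exists_isContinuum_or_separation hS.isCompact hA hB with
    ⟨C, h1, h2, ⟨⟨z, s⟩, h3, h3'⟩, ⟨⟨z', s'⟩, h4, h4'⟩⟩ | ⟨P, Q, hP, hQ, hd, hPQ, hAP, hBQ⟩
  · obtain rfl : s = 0 := h3'
    obtain rfl : s' = 1 := h4'
    exact ⟨C, h1, h2, ⟨z, h3⟩, ⟨z', h4⟩⟩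
  · exfalso
    have hPS : P ⊆ {x | F x = 0} := hPQ ▸ subset_union_left
    have hQS : Q ⊆ {x | F x = 0} := hPQ ▸ subset_union_right
    have hdisj : Disjoint (P ∪ {x | x.2 = 0}) (Q ∪ {x | x.2 = 1}) := by
      rw [disjoint_left]
      rintro x (h | h) (h' | h')
      · exact disjoint_left.1 hd h h'
      · exact disjoint_left.1 hd h (hBQ ⟨hPS h, h'⟩)
      · exact disjoint_left.1 hd (hAP ⟨hQS h', h⟩) h'
      · exact zero_ne_one (h.symm.trans h' : (0 : I) = 1)
    obtain ⟨g, hg0, hg1, -⟩ := exists_continuous_zero_one_of_isClosed (hP.isClosed.union hA)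
      (hQ.isClosed.union hB) hdisj
    have hg0' : ∀ x, x ∈ P ∪ {x : Z × I | x.2 = 0} → g x = 0 := fun x hx => hg0 hx
    have hg1' : ∀ x, x ∈ Q ∪ {x : Z × I | x.2 = 1} → g x = 1 := fun x hx => hg1 hx
    -- Where `F = 0` the imaginary part is `-1` on `P` and `1` on `Q`, so a separation of the zero
    -- set would make `w` nonvanishing.
    let w : C(I × Z, ℂ) :=
      ⟨fun x => (F (x.2, x.1) : ℂ) + ((2 * g (x.2, x.1) - 1 : ℝ) : ℂ) * Complex.I, by fun_prop⟩
    have hre : ∀ s z, (w (s, z)).re = F (z, s) := fun s z => by simp [w]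
    have him : ∀ s z, (w (s, z)).im = 2 * g (z, s) - 1 := fun s z => by simp [w]
    refine false_of_winding w ?_ ?_ ?_ (p := p) (q := q) (fun s => by rw [hre]; exact hp s)
      (fun s => by rw [hre]; exact hq s)
    · rintro ⟨s, z⟩ h
      have h1 : F (z, s) = 0 := by rw [← hre, h, Complex.zero_re]
      have h2 : 2 * g (z, s) - 1 = 0 := by rw [← him, h, Complex.zero_im]
      rcases (hPQ.symm ▸ h1 : (z, s) ∈ P ∪ Q) with h3 | h3
      · rw [hg0' _ (Or.inl h3)] at h2; norm_num at h2
      · rw [hg1' _ (Or.inl h3)] at h2; norm_num at h2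
    · intro z
      rw [him, hg0' _ (Or.inr rfl)]; norm_num
    · intro z
      rw [him, hg1' _ (Or.inr rfl)]; norm_num

/-! ### A planar horseshoe pulled back to a product. -/

/-- A plateau function on the line: `0` off `(1/10, 9/10)` and `9/10` on `[4/10, 6/10]`. -/
noncomputable def plateau (x : ℝ) : ℝ := max 0 (min (9 / 10) (6 / 5 - 3 * |x - 1 / 2|))

theorem continuous_plateau : Continuous plateau := by unfold plateau; fun_prop

theorem plateau_nonneg (x : ℝ) : 0 ≤ plateau x := le_max_left _ _

theorem plateau_le (x : ℝ) : plateau x ≤ 9 / 10 := max_le (by norm_num) (min_le_left _ _)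

/-- A homeomorphism of the plane with a horseshoe. -/
noncomputable def foldMap (p : ℝ × ℝ) : ℝ × ℝ := (plateau p.1 + p.2 / 10, p.1)

/-- The inverse of `foldMap`. -/
noncomputable def unfoldMap (p : ℝ × ℝ) : ℝ × ℝ := (p.2, 10 * (p.1 - plateau p.2))

theorem unfoldMap_foldMap (p : ℝ × ℝ) : unfoldMap (foldMap p) = p := by
  ext
  · rfl
  · simp only [unfoldMap, foldMap]; ring

theorem foldMap_unfoldMap (p : ℝ × ℝ) : foldMap (unfoldMap p) = p := by
  ext
  · simp only [unfoldMap, foldMap]; ring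
  · rfl

theorem continuous_foldMap : Continuous foldMap := by
  have := continuous_plateau
  unfold foldMap; fun_prop

theorem continuous_unfoldMap : Continuous unfoldMap := by
  have := continuous_plateau
  unfold unfoldMap; fun_prop

/-- The constants fit exactly: the plateau contributes at most `9/10` and the second coordinate at
most `1/10`. -/
theorem mapsTo_foldMap :
    MapsTo foldMap (Icc (0 : ℝ) 1 ×ˢ Icc (0 : ℝ) 1) (Icc (0 : ℝ) 1 ×ˢ Icc (0 : ℝ) 1) := by
  rintro ⟨a, b⟩ ⟨ha, hb⟩
  have h1 := plateau_nonneg a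
  have h2 := plateau_le a
  simp only [mem_Icc] at ha hb
  refine ⟨⟨?_, ?_⟩, ha⟩ <;> simp only [foldMap] <;> linarith

/-- The product of a nondegenerate continuum with an interval contains an indecomposable
continuum. -/
theorem exists_isIndecomposable_prod {Z : Type*} [TopologicalSpace Z] [CompactSpace Z] [T2Space Z]
    [ConnectedSpace Z] {π : Z → ℝ} (hπ : Continuous π) {p q : Z} (hpq : π p ≠ π q) :
    ∃ K : Set (Z × I), IsIndecomposable K := by
  -- The values `-1` and `2` at `p` and `q` lie on either side of `[0,1]`, which gives the strict
  -- signs needed for a crossing.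
  let g : Z → ℝ := fun z => -1 + 3 * ((π z - π p) / (π q - π p))
  have hg : Continuous g := by fun_prop
  have hgp : g p = -1 := by simp [g]
  have hgq : g q = 2 := by
    simp only [g]
    rw [div_self (sub_ne_zero.2 hpq.symm)]; norm_num
  let Q : Set (ℝ × ℝ) := Icc (0 : ℝ) 1 ×ˢ Icc (0 : ℝ) 1
  have hQ : IsClosed Q := isClosed_Icc.prod isClosed_Icc
  let Ξ : ℕ → Z × I → ℝ × ℝ := fun k x => unfoldMap^[k] ((x.2 : ℝ), g x.1)
  have hΞ : ∀ k, Continuous (Ξ k) := fun k =>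
    (continuous_unfoldMap.iterate k).comp (by fun_prop)
  have hΞs : ∀ k x, Ξ (k + 1) x = unfoldMap (Ξ k x) := fun k x =>
    Function.iterate_succ_apply' _ _ _
  have hξ : ∀ k, Continuous fun x => (Ξ k x).1 := fun k => continuous_fst.comp (hΞ k)
  have hstep : ∀ A : Set (Z × I), IsContinuum A → ∀ k, (∀ x ∈ A, Ξ (k + 1) x ∈ Q) →
      (Icc (1 / 10 : ℝ) (4 / 10) ⊆ (fun x => (Ξ (k + 1) x).1) '' A ∨
        Icc (6 / 10 : ℝ) (9 / 10) ⊆ (fun x => (Ξ (k + 1) x).1) '' A) →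
      Icc (1 / 10 : ℝ) (9 / 10) ⊆ (fun x => (Ξ k x).1) '' A := by
    intro A hA k hAQ h
    have hval : ∀ x, (Ξ k x).1 = plateau (Ξ (k + 1) x).1 + (Ξ (k + 1) x).2 / 10 := fun x => by
      rw [← foldMap_unfoldMap (Ξ k x), ← hΞs]; rfl
    have low : ∀ x ∈ A, plateau (Ξ (k + 1) x).1 = 0 → (Ξ k x).1 ≤ 1 / 10 := fun x hx h0 => by
      have := (hAQ x hx).2.2
      rw [hval, h0]; linarith
    have high : ∀ x ∈ A, plateau (Ξ (k + 1) x).1 = 9 / 10 → 9 / 10 ≤ (Ξ k x).1 :=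
      fun x hx h0 => by
      have := (hAQ x hx).2.1
      rw [hval, h0]; linarith
    have p1 : plateau (1 / 10) = 0 := by norm_num [plateau, abs_of_nonneg, abs_of_nonpos]
    have p4 : plateau (4 / 10) = 9 / 10 := by norm_num [plateau, abs_of_nonneg, abs_of_nonpos]
    have p6 : plateau (6 / 10) = 9 / 10 := by norm_num [plateau, abs_of_nonneg, abs_of_nonpos]
    have p9 : plateau (9 / 10) = 0 := by norm_num [plateau, abs_of_nonneg, abs_of_nonpos]
    rcases h with h | h
    · obtain ⟨x, hx, hx'⟩ := h (show (1 / 10 : ℝ) ∈ _ by constructor <;> norm_num)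
      obtain ⟨y, hy, hy'⟩ := h (show (4 / 10 : ℝ) ∈ _ by constructor <;> norm_num)
      exact Icc_subset_image hA.2.isPreconnected (hξ k) hx hy
        (low x hx (by rw [← p1, ← hx'])) (high y hy (by rw [← p4, ← hy']))
    · obtain ⟨x, hx, hx'⟩ := h (show (9 / 10 : ℝ) ∈ _ by constructor <;> norm_num)
      obtain ⟨y, hy, hy'⟩ := h (show (6 / 10 : ℝ) ∈ _ by constructor <;> norm_num)
      exact Icc_subset_image hA.2.isPreconnected (hξ k) hx hy
        (low x hx (by rw [← p9, ← hx'])) (high y hy (by rw [← p6, ← hy']))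
  -- For each `N`, pull the arc `s ↦ foldMap^[N] (s, 0)` back to `Z × I`. Along the resulting
  -- continuum the first `N` unfoldings stay in `Q`, and the last one returns to the full base
  -- segment.
  have hC : ∀ N : ℕ, ∃ C : Set (Z × I), IsContinuum C ∧ ∀ k ≤ N, (∀ x ∈ C, Ξ k x ∈ Q) ∧
      Icc (1 / 10 : ℝ) (9 / 10) ⊆ (fun x => (Ξ k x).1) '' C := by
    intro N
    have hin : ∀ n (s : I), foldMap^[n] ((s : ℝ), 0) ∈ Q := fun n s =>
      mapsTo_foldMap.iterate n ⟨s.2, by simp⟩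
    have hcont : Continuous fun s : I => foldMap^[N] ((s : ℝ), 0) :=
      (continuous_foldMap.iterate N).comp (by fun_prop)
    obtain ⟨C, hCF, hC, ⟨z₀, hz₀⟩, ⟨z₁, hz₁⟩⟩ := exists_continuum_crossing
      (F := fun x : Z × I => g x.1 - (foldMap^[N] ((x.2 : ℝ), 0)).2)
      ((hg.comp continuous_fst).sub (continuous_snd.comp (hcont.comp continuous_snd)))
      (p := p) (q := q) (fun s => by simp only [hgp]; linarith [(hin N s).2.1])
      (fun s => by simp only [hgq]; linarith [(hin N s).2.2])
    -- The crossing continuum is parametrized by `s` and `z` with matching second coordinates; `h`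
    -- replaces `s` by the first coordinate of the arc at `s`.
    let h : Z × I → Z × I := fun x => (x.1, ⟨(foldMap^[N] ((x.2 : ℝ), 0)).1, (hin N x.2).1⟩)
    have hh : Continuous h := continuous_fst.prodMk
      ((continuous_fst.comp (hcont.comp continuous_snd)).subtype_mk _)
    have hΞh : ∀ n k, n + k = N → ∀ x ∈ C, Ξ k (h x) = foldMap^[n] ((x.2 : ℝ), 0) := by
      rintro n k rfl x hx
      have h1 : (((h x).2 : ℝ), g (h x).1) = foldMap^[k] (foldMap^[n] ((x.2 : ℝ), 0)) := by
        rw [← Function.iterate_add_apply, add_comm k n]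
        ext
        · rfl
        · exact sub_eq_zero.1 (hCF hx)
      have h2 : Function.LeftInverse unfoldMap foldMap := unfoldMap_foldMap
      simp only [Ξ]
      rw [h1]
      exact h2.iterate k _
    have hCh : IsContinuum (h '' C) := hC.image hh.continuousOn
    have hmem : ∀ k ≤ N, ∀ x ∈ h '' C, Ξ k x ∈ Q := by
      rintro k hk _ ⟨x, hx, rfl⟩
      rw [hΞh (N - k) k (by omega) x hx]
      exact hin _ _
    refine ⟨h '' C, hCh, fun k hk => ⟨hmem k hk, ?_⟩⟩
    induction hk using Nat.decreasingInduction with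
    | self =>
      refine Icc_subset_image hCh.2.isPreconnected (hξ N) ⟨_, hz₀, rfl⟩ ⟨_, hz₁, rfl⟩ ?_ ?_
      · rw [hΞh 0 N (by omega) _ hz₀]; norm_num
      · rw [hΞh 0 N (by omega) _ hz₁]; norm_num
    | of_succ k hk ih =>
      exact hstep _ hCh k (hmem (k + 1) hk)
        (Or.inl ((Icc_subset_Icc_right (by norm_num)).trans ih))
  choose C hC hCN using hC
  -- The limit continuum satisfies the conditions for all `k` at once, since each of them holds from
  -- stage `k` on.
  obtain ⟨S, hS, hSmeet, hSsub⟩ := exists_limit_continuum C fun n => (hC n).2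
  have hSQ : ∀ k, ∀ x ∈ S, Ξ k x ∈ Q := fun k =>
    hSsub (Ξ k ⁻¹' Q) (hQ.preimage (hΞ k)) ((eventually_ge_atTop k).mono fun n hn => (hCN n k hn).1)
  obtain ⟨K, -, hK⟩ := exists_isIndecomposable_of_horseshoe hS (fun k x => (Ξ k x).1) hξ
    (a := 1 / 10) (b := 4 / 10) (c := 6 / 10) (d := 9 / 10) (by norm_num) (by norm_num)
    (by norm_num) (fun k r hr => by
      obtain ⟨x, hx, hx'⟩ := hSmeet ((fun x => (Ξ k x).1) ⁻¹' {r})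
        (isClosed_singleton.preimage (hξ k)) ((eventually_ge_atTop k).mono fun n hn => by
          obtain ⟨x, hx, hx'⟩ := (hCN n k hn).2 hr
          exact ⟨x, hx, hx'⟩)
      exact ⟨x, hx, hx'⟩)
    (fun A hAS hA k => hstep A hA k fun x hx => hSQ _ x (hAS hx))
  exact ⟨K, hK⟩

/-! ### Graphs with interior. -/

/-- A continuum contains a subcontinuum lying exactly over a prescribed interval of values. -/
theorem exists_subcontinuum_over_Icc {α β : Type*} [TopologicalSpace α] [T2Space α]
    [LinearOrder β] [TopologicalSpace β] [OrderClosedTopology β] {X : Set α} (hX : IsContinuum X)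
    {g : α → β} (hg : Continuous g) {u v : β} (huv : u < v) (hu : u ∈ g '' X) (hv : v ∈ g '' X) :
    ∃ Z ⊆ X, IsContinuum Z ∧ g '' Z = Icc u v := by
  rcases exists_isContinuum_or_separation (hX.1.inter_right (isClosed_Icc.preimage hg))
    (A := g ⁻¹' {u}) (B := g ⁻¹' {v}) (isClosed_singleton.preimage hg)
    (isClosed_singleton.preimage hg) with
    ⟨Z, hZ, hZc, ⟨x, hx, hxu⟩, ⟨y, hy, hyv⟩⟩ | ⟨P, Q, hP, hQ, hd, hPQ, hAP, hBQ⟩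
  · refine ⟨Z, hZ.trans inter_subset_left, hZc, Subset.antisymm ?_ ?_⟩
    · rintro _ ⟨z, hz, rfl⟩
      exact (hZ hz).2
    · exact Icc_subset_image hZc.2.isPreconnected hg hx hy (le_of_eq hxu) (ge_of_eq hyv)
  · exfalso
    obtain ⟨x, hx, hxu⟩ := hu
    obtain ⟨y, hy, hyv⟩ := hv
    have hPs : ∀ w ∈ P, w ∈ X ∧ g w ∈ Icc u v := fun w hw => by
      have : w ∈ P ∪ Q := Or.inl hw
      rwa [hPQ] at this
    have hQs : ∀ w ∈ Q, w ∈ X ∧ g w ∈ Icc u v := fun w hw => by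
      have : w ∈ P ∪ Q := Or.inr hw
      rwa [hPQ] at this
    -- Adding the points with values at most `u` to one piece and those with values at least `v` to
    -- the other would separate `X`.
    have := isPreconnected_closed_iff.1 hX.2.isPreconnected (P ∪ X ∩ g ⁻¹' Iic u)
      (Q ∪ X ∩ g ⁻¹' Ici v) (hP.isClosed.union (hX.1.isClosed.inter (isClosed_Iic.preimage hg)))
      (hQ.isClosed.union (hX.1.isClosed.inter (isClosed_Ici.preimage hg))) (fun w hw => by
        rcases le_total (g w) u with h | h
        · exact Or.inl (Or.inr ⟨hw, h⟩)
        rcases le_total v (g w) with h' | h'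
        · exact Or.inr (Or.inr ⟨hw, h'⟩)
        have : w ∈ P ∪ Q := hPQ.symm ▸ ⟨hw, h, h'⟩
        exact this.imp Or.inl Or.inl) ⟨x, hx, Or.inr ⟨hx, hxu.le⟩⟩ ⟨y, hy, Or.inr ⟨hy, hyv.ge⟩⟩
    obtain ⟨w, hw, h1, h2⟩ := this
    rcases h1 with h1 | h1 <;> rcases h2 with h2 | h2
    · exact disjoint_left.1 hd h1 h2
    · exact disjoint_left.1 hd h1
        (hBQ ⟨hPs w h1, le_antisymm (hPs w h1).2.2 h2.2⟩)
    · exact disjoint_left.1 hd (hAP ⟨hQs w h2, le_antisymm h1.2 (hQs w h2).2.1⟩) h2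
    · exact absurd (h2.2.trans h1.2) (not_le.2 huv)

/-- Near each of its points, a nondegenerate interval contains nondegenerate closed intervals. -/
theorem exists_Icc_subset_inter {L U : Set I} (hL : L.OrdConnected) {x x' : I} (hx : x ∈ L)
    (hx' : x' ∈ L) (hne : x' ≠ x) (hU : U ∈ 𝓝 x) : ∃ u v, u < v ∧ Icc u v ⊆ U ∩ L := by
  rcases lt_or_gt_of_ne hne with h | h
  · obtain ⟨u, hu, hsub⟩ := exists_Ioc_subset_of_mem_nhds hU ⟨x', h⟩
    obtain ⟨w, hw, hw'⟩ := exists_between (max_lt hu h)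
    exact ⟨w, x, hw', fun t ht => ⟨hsub ⟨(max_lt_iff.1 hw).1.trans_le ht.1, ht.2⟩,
      hL.out hx' hx ⟨((max_lt_iff.1 hw).2.trans_le ht.1).le, ht.2⟩⟩⟩
  · obtain ⟨u, hu, hsub⟩ := exists_Ico_subset_of_mem_nhds hU ⟨x', h⟩
    obtain ⟨w, hw, hw'⟩ := exists_between (lt_min hu h)
    exact ⟨x, w, hw, fun t ht => ⟨hsub ⟨ht.1, ht.2.trans_lt (lt_min_iff.1 hw').1⟩,
      hL.out hx hx' ⟨ht.1, (ht.2.trans_lt (lt_min_iff.1 hw').2).le⟩⟩⟩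

theorem cons_mem_inverseLimit {w : ℕ → I} (hw : w ∈ inverseLimit f) {y : I} (hy : y ∈ f (w 0)) :
    cons y w ∈ inverseLimit f := by
  intro i
  cases i with
  | zero => exact hy
  | succ i => exact hw i

/-- If the graph of `f` has interior over the range of the first projection of the inverse limit,
then the inverse limit contains an indecomposable continuum. -/
theorem exists_isIndecomposable_of_interior (hX : IsContinuum (inverseLimit f)) {x x' : I}
    (hx : x ∈ (fun w : ℕ → I => w 0) '' inverseLimit f)
    (hx' : x' ∈ (fun w : ℕ → I => w 0) '' inverseLimit f) (hne : x' ≠ x)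
    (hint : x ∈ Prod.fst '' interior (graph f)) :
    ∃ K ⊆ inverseLimit f, IsIndecomposable K := by
  obtain ⟨⟨x, y⟩, hxy, rfl⟩ := hint
  obtain ⟨U, hU, V, hV, hUV⟩ := mem_nhds_prod_iff.1 (mem_interior_iff_mem_nhds.1 hxy)
  have hc0 : Continuous fun w : ℕ → I => w 0 := continuous_apply 0
  have hL : ((fun w : ℕ → I => w 0) '' inverseLimit f).OrdConnected :=
    (hX.2.isPreconnected.image _ hc0.continuousOn).ordConnected
  obtain ⟨u₀, u₁, hu, huU⟩ := exists_Icc_subset_inter hL hx hx' hne hU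
  obtain ⟨y', hy'⟩ := exists_ne y
  obtain ⟨v₀, v₁, hv, hvV⟩ := exists_Icc_subset_inter ordConnected_univ (mem_univ y) (mem_univ y')
    hy' hV
  obtain ⟨Z, hZX, hZ, hZim⟩ := exists_subcontinuum_over_Icc hX hc0 hu
    (huU ⟨le_rfl, hu.le⟩).2 (huU ⟨hu.le, le_rfl⟩).2
  have : CompactSpace Z := isCompact_iff_compactSpace.1 hZ.1
  have : ConnectedSpace Z := isConnected_iff_connectedSpace.1 hZ.2
  obtain ⟨p, hp, hpu⟩ : u₀ ∈ (fun w : ℕ → I => w 0) '' Z := hZim ▸ ⟨le_rfl, hu.le⟩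
  obtain ⟨q, hq, hqu⟩ : u₁ ∈ (fun w : ℕ → I => w 0) '' Z := hZim ▸ ⟨hu.le, le_rfl⟩
  obtain ⟨K, hK⟩ := exists_isIndecomposable_prod (Z := Z) (π := fun z => ((z : ℕ → I) 0 : ℝ))
    (continuous_subtype_val.comp (hc0.comp continuous_subtype_val)) (p := ⟨p, hp⟩) (q := ⟨q, hq⟩) (by
      intro h
      have h' : p 0 = q 0 := Subtype.ext h
      exact hu.ne (hpu.symm.trans (h'.trans hqu)))
  have hv' : (v₀ : ℝ) < v₁ := hv
  have hmem : ∀ t : I, (v₀ : ℝ) + t * (v₁ - v₀) ∈ Icc (v₀ : ℝ) v₁ := fun t => by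
    have h0 := t.2.1
    have h1 := t.2.2
    constructor <;> nlinarith
  let v : I → I := fun t => ⟨v₀ + t * (v₁ - v₀),
    v₀.2.1.trans (hmem t).1, (hmem t).2.trans v₁.2.2⟩
  have hvc : Continuous v := by fun_prop
  have hvi : Function.Injective v := by
    intro s t hst
    have h : (v₀ : ℝ) + s * (v₁ - v₀) = v₀ + t * (v₁ - v₀) := congrArg Subtype.val hst
    exact Subtype.ext (mul_right_cancel₀ (sub_ne_zero.2 hv'.ne') (add_left_cancel h))
  -- Over `[u₀, u₁]` every value in `[v₀, v₁]` is allowed, so a free first term can be prepended;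
  -- this embeds `Z × I` in the inverse limit.
  let h : Z × I → (ℕ → I) := fun x => cons (v x.2) x.1
  have hh : Continuous h := continuous_cons.comp
    ((continuous_subtype_val.comp continuous_fst).prodMk (hvc.comp continuous_snd))
  have hi : Function.Injective h := by
    rintro ⟨z, s⟩ ⟨z', s'⟩ heq
    have h0 : v s = v s' := congrFun heq 0
    have h1 : (z : ℕ → I) = z' := funext fun n => congrFun heq (n + 1)
    rw [hvi h0, Subtype.ext h1]
  refine ⟨h '' K, ?_, hK.image hh hi.injOn⟩
  rintro _ ⟨⟨z, t⟩, -, rfl⟩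
  refine cons_mem_inverseLimit (hZX z.2) ?_
  have hz : (z : ℕ → I) 0 ∈ Icc u₀ u₁ := hZim ▸ ⟨z, z.2, rfl⟩
  exact hUV (mk_mem_prod (huU hz).1 (hvV ⟨(hmem t).1, (hmem t).2⟩).1)

/-! ### The thin domain and the proof of part 1. -/

theorem uIoo_subset_of_mem {J : Set I} (hJ : J.OrdConnected) {c d : I} (hc : c ∈ J) (hd : d ∈ J) :
    uIoo c d ⊆ J :=
  uIoo_subset_uIcc_self.trans (hJ.uIcc_subset hc hd)

/-- Over a nondegenerate interval where `f` is almost nonfissile, coordinate projections of closed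
subsets of the inverse limit are mapped onto each other by `f`. -/
theorem image_subset_eval (hivp : HasIVP f)
    (hanf : IsAlmostNonfissile ((thinDomain f).domRestrict f)) {A : Set (ℕ → I)}
    (hAX : A ⊆ inverseLimit f) (hA : IsCompact A) {J : Set I} (hJ : J.OrdConnected)
    (hJ' : J.Nontrivial) (hJD : J ⊆ thinDomain f) {k : ℕ}
    (hcov : J ⊆ (fun w : ℕ → I => w (k + 1)) '' A) :
    SetValued.image f J ⊆ (fun w : ℕ → I => w k) '' A := by
  have hcl : IsClosed ((fun w : ℕ → I => w k) '' A) :=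
    (hA.image (continuous_apply k)).isClosed
  -- A thread of `A` through a nonfissile point has no choice of its next value. These values
  -- accumulate at `y`, and the projection of `A` is closed.
  have hopen : ∀ c ∈ J, ∀ d ∈ J, ∀ x ∈ uIoo c d, ∀ y ∈ f x, y ∈ (fun w : ℕ → I => w k) '' A := by
    intro c hc d hd x hx y hy
    have hsub := uIoo_subset_of_mem hJ hc hd
    rw [← hcl.closure_eq, mem_closure_iff]
    intro V hV hyV
    let P : Set (graph ((thinDomain f).domRestrict f)) :=
      {p | (p.1.1 : I) ∈ uIoo c d ∧ p.1.2 ∈ V}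
    have hP : IsOpen P :=
      (IsOpen.preimage (by fun_prop : Continuous fun p : graph ((thinDomain f).domRestrict f) =>
        (p.1.1 : I)) (isOpen_Ioo : IsOpen (uIoo c d))).inter (hV.preimage (by fun_prop))
    obtain ⟨p, hpP, hpn⟩ := hanf.2.exists_mem_open hP ⟨⟨(⟨x, hJD (hsub hx)⟩, y), hy⟩, hx, hyV⟩
    obtain ⟨a, ha, hax⟩ := hcov (hsub hpn.1)
    refine ⟨p.1.2, hpn.2, a, ha, ?_⟩
    have h1 : a k ∈ f (p.1.1 : I) := by
      have := hAX ha k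
      rwa [show a (k + 1) = (p.1.1 : I) from hax] at this
    exact (not_nontrivial_iff.1 hpP) h1 p.2
  intro y hy
  obtain ⟨x, hx, hy⟩ := mem_image_iff.1 hy
  obtain ⟨e₀, he₀, hne⟩ := hJ'.exists_ne x
  obtain ⟨e, he⟩ := nonempty_uIoo.2 hne.symm
  obtain ⟨w, hw⟩ := (f e).nonempty
  by_cases hwy : w = y
  · exact hopen x hx e₀ he₀ e he y (hwy ▸ hw)
  -- Here `x` may be an endpoint of `J`. Values strictly between `y` and `w` are taken strictly
  -- inside, and `y` is a limit of them.
  · have hxe : x ≠ e := fun h => left_notMem_uIoo (h ▸ he : x ∈ uIoo x e₀)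
    have hsub : uIoo y w ⊆ (fun w : ℕ → I => w k) '' A := by
      intro t ht
      obtain ⟨x'', hx'', ht'⟩ := hivp x e hxe y hy w hw t ht
      exact hopen x hx e (uIoo_subset_of_mem hJ hx he₀ he) x'' hx'' t ht'
    refine hcl.closure_subset_iff.2 hsub ?_
    rcases lt_or_gt_of_ne hwy with h | h
    · rw [uIoo_of_gt h, closure_Ioo h.ne]
      exact ⟨h.le, le_rfl⟩
    · rw [uIoo_of_lt h, closure_Ioo h.ne]
      exact ⟨le_rfl, h.le⟩

/-- A light function does not collapse nondegenerate intervals. -/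
theorem image_nontrivial (hl : IsLight ((thinDomain f).domRestrict f)) {J : Set I}
    (hJ : J.OrdConnected) (hJ' : J.Nontrivial) (hJD : J ⊆ thinDomain f) :
    (SetValued.image f J).Nontrivial := by
  by_contra hcon
  rw [not_nontrivial_iff] at hcon
  obtain ⟨c, hc, d, hd, hne⟩ := hJ'
  obtain ⟨y, hy⟩ := (f c).nonempty
  obtain ⟨e, he⟩ := nonempty_uIoo.2 hne
  have hsub : uIoo c d ⊆ interior ((↑) '' {x : thinDomain f | y ∈ (thinDomain f).domRestrict f x} :
      Set I) := by
    refine interior_maximal (fun x hx => ?_) (isOpen_Ioo : IsOpen (uIoo c d))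
    have hxJ := uIoo_subset_of_mem hJ hc hd hx
    refine ⟨⟨x, hJD hxJ⟩, ?_, rfl⟩
    obtain ⟨z, hz⟩ := (f x).nonempty
    have : z = y := hcon (mem_image_iff.2 ⟨x, hxJ, hz⟩) (mem_image_iff.2 ⟨c, hc, hy⟩)
    exact this ▸ hz
  have := hsub he
  rw [hl y] at this
  exact this

theorem eval_zero_subset_eval (j : ℕ) :
    (fun w : ℕ → I => w 0) '' inverseLimit f ⊆ (fun w : ℕ → I => w j) '' inverseLimit f := by
  induction j with
  | zero => exact subset_rfl
  | succ j ih =>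
    intro x hx
    obtain ⟨w, hw, rfl⟩ := ih hx
    obtain ⟨y, hy⟩ := (f (w 0)).nonempty
    exact ⟨cons y w, cons_mem_inverseLimit hw hy, rfl⟩

/-- This forward invariance keeps all iterates of an interval in the thin domain in
`exists_isIndecomposable_of_cycle`. -/
theorem image_eval_zero_subset {J : Set I} (hJ : J ⊆ (fun w : ℕ → I => w 0) '' inverseLimit f) :
    SetValued.image f J ⊆ (fun w : ℕ → I => w 0) '' inverseLimit f := by
  intro y hy
  obtain ⟨x, hx, hy⟩ := mem_image_iff.1 hy
  obtain ⟨w, hw, rfl⟩ := hJ hx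
  exact ⟨cons y w, cons_mem_inverseLimit hw hy, rfl⟩

/-- If `f` is almost nonfissile and light on its thin domain and has a cycle whose period is not a
power of two, then its inverse limit contains an indecomposable continuum. -/
theorem exists_isIndecomposable_of_cycle (husc : IsUSC f) (hivp : HasIVP f)
    (hanf : IsAlmostNonfissile ((thinDomain f).domRestrict f))
    (hl : IsLight ((thinDomain f).domRestrict f)) {p : ℕ} (hp : HasCycleOfPeriod f p)
    (hp2 : ¬ ∃ k : ℕ, p = 2 ^ k) : ∃ K ⊆ inverseLimit f, IsIndecomposable K := by
  have hG := isClosed_graph husc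
  have hI := ordConnected_of_hasIVP husc hivp
  have hX := isContinuum_inverseLimit hG hI
  obtain ⟨N, a, b, c, d, ha, hd, hab, hbc, hcd, h1, h2⟩ := exists_horseshoe hG hI hp hp2
  have had : a < d := hab.trans_le (hbc.trans hcd.le)
  set L : Set I := (fun w : ℕ → I => w 0) '' inverseLimit f with hLdef
  have hev : ∀ j, Continuous fun w : ℕ → I => w j := fun j => continuous_apply j
  by_cases hLD : L ⊆ thinDomain f
  · have hLc : L.OrdConnected := (hX.2.isPreconnected.image _ (hev 0).continuousOn).ordConnected
    have hit : ∀ A ⊆ inverseLimit f, IsCompact A → ∀ n k J, IsContinuum J → J.Nontrivial →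
        J ⊆ L → J ⊆ (fun w : ℕ → I => w (k + n)) '' A →
        (SetValued.image f)^[n] J ⊆ (fun w : ℕ → I => w k) '' A := by
      intro A hAX hA n
      induction n with
      | zero => exact fun k J _ _ _ h => h
      | succ n ih =>
        intro k J hJ hJ' hJL h
        have hJo := hJ.2.isPreconnected.ordConnected
        exact ih k _ (hJ.setValued_image hG hI) (image_nontrivial hl hJo hJ' (hJL.trans hLD))
          (image_eval_zero_subset hJL)
          (image_subset_eval hivp hanf hAX hA hJo hJ' (hJL.trans hLD) h)
    have hnt : ∀ u v : I, u < v → (Icc u v).Nontrivial := fun u v h =>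
      ⟨u, ⟨le_rfl, h.le⟩, v, ⟨h.le, le_rfl⟩, h.ne⟩
    -- One step of the horseshoe takes `N` applications of `f`, hence the coordinates at multiples
    -- of `N`.
    refine exists_isIndecomposable_of_horseshoe hX (fun k (w : ℕ → I) => w (k * N))
      (fun k => hev _) hab hbc hcd (fun k => ?_) (fun A hAX hA k h => ?_)
    · exact (hX.2.isPreconnected.image _ (hev (k * N)).continuousOn).ordConnected.out
        (eval_zero_subset_eval _ ha) (eval_zero_subset_eval _ hd)
    · rw [show (k + 1) * N = k * N + N by ring] at h
      rcases h with h | h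
      · exact h1.trans (hit A hAX hA.1 N _ _ (isContinuum_Icc hab.le) (hnt _ _ hab)
          ((Icc_subset_Icc_right (hbc.trans hcd.le)).trans (hLc.out ha hd)) h)
      · exact h2.trans (hit A hAX hA.1 N _ _ (isContinuum_Icc hcd.le) (hnt _ _ hcd)
          ((Icc_subset_Icc_left (hab.le.trans hbc)).trans (hLc.out ha hd)) h)
  · obtain ⟨x, hx, hxD⟩ := not_subset.1 hLD
    have hint : x ∈ Prod.fst '' interior (graph f) := not_not.1 hxD
    -- The values of coordinate 0 must include a point other than `x`; `a` or `d` provides it.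
    by_cases hxa : a = x
    · exact exists_isIndecomposable_of_interior hX hx hd (fun h => had.ne (hxa.trans h.symm)) hint
    · exact exists_isIndecomposable_of_interior hX hx ha hxa hint

/-! ### Irreducibility in indecomposable continua. -/

/-- In a connected space, adding one side of a separation of the complement of a continuum keeps it
connected. -/
theorem isPreconnected_union_of_separation {Y : Type*} [TopologicalSpace Y] [PreconnectedSpace Y]
    {C U V : Set Y} (hC : IsConnected C) (hU : IsOpen U) (hV : IsOpen V) (hCV : (C ∪ U)ᶜ = V) : IsPreconnected (C ∪ U) := by
  have hcl : IsClosed (C ∪ U) := ⟨hCV ▸ hV⟩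
  rw [isPreconnected_iff_subset_of_fully_disjoint_closed hcl]
  have main : ∀ s t : Set Y, IsClosed s → IsClosed t → C ∪ U ⊆ s ∪ t → Disjoint s t → C ⊆ s →
      C ∪ U ⊆ s := by
    intro s t hs ht hst hd hCs
    -- The part in `t` avoids `C`, so it is open as well as closed in the whole space.
    have heq : (C ∪ U) ∩ t = U ∩ sᶜ := by
      ext x
      constructor
      · rintro ⟨h1, h2⟩
        have hxs : x ∉ s := fun h => disjoint_left.1 hd h h2
        exact ⟨h1.resolve_left fun h => hxs (hCs h), hxs⟩
      · rintro ⟨h1, h2⟩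
        exact ⟨Or.inr h1, (hst (Or.inr h1)).resolve_left h2⟩
    have hclopen : IsClopen ((C ∪ U) ∩ t) :=
      ⟨hcl.inter ht, heq ▸ hU.inter hs.isOpen_compl⟩
    rcases isClopen_iff.1 hclopen with h | h
    · intro x hx
      refine (hst hx).resolve_right fun hxt => ?_
      exact (h ▸ ⟨hx, hxt⟩ : x ∈ (∅ : Set Y))
    · obtain ⟨c, hc⟩ := hC.nonempty
      exact absurd ((h.symm ▸ mem_univ c : c ∈ (C ∪ U) ∩ t)).2 (disjoint_left.1 hd (hCs hc))
  intro s t hs ht hst hd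
  rcases (isPreconnected_iff_subset_of_disjoint_closed.1 hC.isPreconnected) s t hs ht
    (subset_union_left.trans hst) (by rw [hd.inter_eq, inter_empty]) with h | h
  · exact Or.inl (main s t hs ht hst hd h)
  · exact Or.inr (main t s ht hs (by rwa [union_comm t s]) hd.symm h)

/-- Proper subcontinua of indecomposable continua have empty interior. -/
theorem interior_eq_empty_of_indecomposable {Y : Type*} [TopologicalSpace Y] [ConnectedSpace Y]
    (hind : ∀ A B : Set Y, IsClosed A → IsConnected A → IsClosed B → IsConnected B →
      A ∪ B = univ → A = univ ∨ B = univ)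
    {C : Set Y} (hCc : IsClosed C) (hC : IsConnected C) (hne : C ≠ univ) : interior C = ∅ := by
  by_cases hpre : IsPreconnected Cᶜ
  · have hcon : IsConnected (closure Cᶜ) :=
      IsConnected.closure ⟨nonempty_compl.2 hne, hpre⟩
    rcases hind C (closure Cᶜ) hCc hC isClosed_closure hcon
      (eq_univ_of_univ_subset (by
        rw [← union_compl_self C]; exact union_subset_union_right _ subset_closure)) with h | h
    · exact absurd h hne
    · rw [interior_eq_compl_closure_compl, h, compl_univ]
  -- If the complement splits, `C` together with either piece is a proper subcontinuum, and the two
  -- cover the space.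
  · exfalso
    rw [isPreconnected_iff_subset_of_disjoint] at hpre
    push Not at hpre
    obtain ⟨u, v, hu, hv, huv, hd, h1, h2⟩ := hpre
    have hU : IsOpen (Cᶜ ∩ u) := hCc.isOpen_compl.inter hu
    have hV : IsOpen (Cᶜ ∩ v) := hCc.isOpen_compl.inter hv
    have hdd : ∀ x, x ∉ C → x ∈ u → x ∈ v → False := fun x hx hxu hxv => by
      have : x ∈ Cᶜ ∩ (u ∩ v) := ⟨hx, hxu, hxv⟩
      rw [hd] at this
      exact this
    have e1 : (C ∪ (Cᶜ ∩ u))ᶜ = Cᶜ ∩ v := by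
      ext x
      have h3 := @huv x
      have h4 := hdd x
      simp only [mem_compl_iff, mem_union, mem_inter_iff] at *
      tauto
    have e2 : (C ∪ (Cᶜ ∩ v))ᶜ = Cᶜ ∩ u := by
      ext x
      have h3 := @huv x
      have h4 := hdd x
      simp only [mem_compl_iff, mem_union, mem_inter_iff] at *
      tauto
    have c1 := isPreconnected_union_of_separation hC hU hV e1
    have c2 := isPreconnected_union_of_separation hC hV hU e2
    rcases hind _ _ ⟨e1 ▸ hV⟩ ⟨hC.nonempty.mono subset_union_left, c1⟩ ⟨e2 ▸ hU⟩
      ⟨hC.nonempty.mono subset_union_left, c2⟩ (by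
        ext x
        have h3 := @huv x
        simp only [mem_compl_iff, mem_union, mem_inter_iff, mem_univ, iff_true] at *
        tauto) with h | h
    · obtain ⟨x, hx, hx'⟩ := not_subset.1 h1
      have : x ∈ (C ∪ (Cᶜ ∩ u)) := h ▸ mem_univ x
      exact this.elim hx fun h => hx' h.2
    · obtain ⟨x, hx, hx'⟩ := not_subset.1 h2
      have : x ∈ (C ∪ (Cᶜ ∩ v)) := h ▸ mem_univ x
      exact this.elim hx fun h => hx' h.2

/-- A compact connected indecomposable second countable space contains an infinite sequence of
points no two of which lie in a common proper subcontinuum. -/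
theorem exists_seq_composants {Y : Type*} [TopologicalSpace Y] [CompactSpace Y] [T2Space Y]
    [SecondCountableTopology Y] [ConnectedSpace Y]
    (hind : ∀ A B : Set Y, IsClosed A → IsConnected A → IsClosed B → IsConnected B →
      A ∪ B = univ → A = univ ∨ B = univ) :
    ∃ x : ℕ → Y, ∀ i j, i < j → ∀ C, IsClosed C → IsConnected C → x i ∈ C → x j ∈ C →
      C = univ := by
  classical
  obtain ⟨x, -, hx⟩ := exists_seq_of_forall_finset_exists (fun _ : Y => True)
    (fun p q => ∀ C, IsClosed C → IsConnected C → p ∈ C → q ∈ C → C = univ) (by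
    intro s _
    let ι := {b : Set Y // b ∈ TopologicalSpace.countableBasis Y} × s
    -- A proper subcontinuum through `p` misses a basic open set `b`, so it lies in the component of
    -- `p` in `bᶜ`. These are countably many closed sets without interior, and Baire's theorem gives
    -- a point outside all of them.
    let D : ι → Set Y := fun i => (connectedComponentIn (i.1.1)ᶜ i.2.1)ᶜ
    have hbo : ∀ i : ι, IsOpen i.1.1 := fun i => TopologicalSpace.isOpen_of_mem_countableBasis i.1.2
    have hcl : ∀ i : ι, IsClosed (connectedComponentIn (i.1.1)ᶜ i.2.1) := fun i => by
      by_cases hmem : i.2.1 ∈ (i.1.1)ᶜ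
      · refine closure_subset_iff_isClosed.1 ?_
        exact isPreconnected_connectedComponentIn.closure.subset_connectedComponentIn
          (subset_closure (mem_connectedComponentIn hmem))
          (closure_minimal (connectedComponentIn_subset _ _) (hbo i).isClosed_compl)
      · rw [connectedComponentIn_eq_empty hmem]
        exact isClosed_empty
    have : Countable {b : Set Y // b ∈ TopologicalSpace.countableBasis Y} :=
      (TopologicalSpace.countable_countableBasis Y).to_subtype
    have hdense : Dense (⋂ i, D i) := by
      refine dense_iInter_of_isOpen (fun i => (hcl i).isOpen_compl) fun i => ?_
      rw [← interior_eq_empty_iff_dense_compl]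
      by_cases hmem : i.2.1 ∈ (i.1.1)ᶜ
      · refine interior_eq_empty_of_indecomposable hind (hcl i)
          (isConnected_connectedComponentIn_iff.2 hmem) fun h => ?_
        obtain ⟨y, hy⟩ := TopologicalSpace.nonempty_of_mem_countableBasis i.1.2
        exact connectedComponentIn_subset _ _ (h ▸ mem_univ y :
          y ∈ connectedComponentIn (i.1.1)ᶜ i.2.1) hy
      · rw [connectedComponentIn_eq_empty hmem, interior_empty]
    obtain ⟨y, hy⟩ := hdense.nonempty
    refine ⟨y, trivial, fun p hp C hCc hC hpC hyC => ?_⟩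
    by_contra hne
    obtain ⟨z, hz⟩ := nonempty_compl.2 hne
    obtain ⟨b, hb, hzb, hbC⟩ := (TopologicalSpace.isBasis_countableBasis Y).exists_subset_of_mem_open
      hz hCc.isOpen_compl
    refine mem_iInter.1 hy (⟨b, hb⟩, ⟨p, hp⟩) ?_
    exact hC.isPreconnected.subset_connectedComponentIn hpC (subset_compl_comm.1 hbC) hyC)
  exact ⟨x, fun i j hij => hx i j hij⟩

/-- An indecomposable continuum is irreducible between any two points of some infinite sequence. -/
theorem IsIndecomposable.exists_seq_irreducible {α : Type*} [TopologicalSpace α] [T2Space α]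
    [SecondCountableTopology α] {K : Set α} (hK : IsIndecomposable K) :
    ∃ x : ℕ → α, ∀ i j, i ≠ j → IsIrreducibleBetween K (x i) (x j) := by
  obtain ⟨hKc, -, hind⟩ := hK
  have : CompactSpace K := isCompact_iff_compactSpace.1 hKc.1
  have : ConnectedSpace K := isConnected_iff_connectedSpace.1 hKc.2
  have hval : ∀ A : Set K, IsClosed A → IsConnected A → IsContinuum (Subtype.val '' A) :=
    fun A h1 h2 => IsContinuum.image ⟨h1.isCompact, h2⟩ continuous_subtype_val.continuousOn
  have huniv : ∀ A : Set K, Subtype.val '' A = K → A = univ := fun A h => by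
    refine eq_univ_of_forall fun y => ?_
    obtain ⟨z, hz, hzy⟩ : (y : α) ∈ Subtype.val '' A := h.symm ▸ y.2
    rwa [← Subtype.ext hzy]
  obtain ⟨x, hx⟩ := exists_seq_composants (Y := K) (by
    intro A B hA hA' hB hB' hAB
    rcases hind _ _ (hval A hA hA') (hval B hB hB') (by
      rw [← image_union, hAB, image_univ, Subtype.range_coe]) with h | h
    · exact Or.inl (huniv A h)
    · exact Or.inr (huniv B h))
  have main : ∀ i j, i < j → ∀ A ⊆ K, IsContinuum A → (x i : α) ∈ A → (x j : α) ∈ A → A = K := by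
    intro i j hij A hAK hA hi hj
    have hpre : IsConnected (Subtype.val ⁻¹' A : Set K) :=
      hA.2.preimage_of_isClosedMap Subtype.val_injective
        hKc.1.isClosed.isClosedEmbedding_subtypeVal.isClosedMap (by rwa [Subtype.range_coe])
    have := hx i j hij _ (hA.1.isClosed.preimage continuous_subtype_val) hpre hi hj
    refine hAK.antisymm fun y hy => ?_
    exact (this.symm ▸ mem_univ (⟨y, hy⟩ : K) : (⟨y, hy⟩ : K) ∈ Subtype.val ⁻¹' A)
  refine ⟨fun i => x i, fun i j hij => ⟨hKc, (x i).2, (x j).2, fun A hAK hA hi hj => ?_⟩⟩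
  rcases lt_or_gt_of_ne hij with h | h
  · exact main i j h A hAK hA hi hj
  · exact main j i h A hAK hA hj hi

/-! ### Closed walks through covering chains. -/

theorem dist_lt_dist_of_mem_uIcc {c d x : I} (hx : x ∈ uIcc c d) (hne : x ≠ d) :
    dist c x < dist c d := by
  rw [Subtype.dist_eq, Subtype.dist_eq, Real.dist_eq, Real.dist_eq]
  rcases mem_uIcc.1 hx with ⟨h1, h2⟩ | ⟨h1, h2⟩
  · have h3 : (x : ℝ) < d := lt_of_le_of_ne h2 fun h => hne (Subtype.ext h)
    have h4 : (c : ℝ) ≤ x := h1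
    rw [abs_of_nonpos (by linarith), abs_of_nonpos (by linarith)]
    linarith
  · have h3 : (d : ℝ) < x := lt_of_le_of_ne h1 fun h => hne (Subtype.ext h.symm)
    have h4 : (x : ℝ) ≤ c := h2
    rw [abs_of_nonneg (by linarith), abs_of_nonneg (by linarith)]
    linarith

/-- A continuum whose image covers an interval contains a continuum with the same property all of
whose points have values in that interval. -/
theorem exists_subcontinuum_image_meets (hG : IsClosed (graph f))
    (hI : ∀ x, (f x : Set I).OrdConnected) {K M : Set I} (hK : IsContinuum K) (hM : IsContinuum M)
    (hKM : M ⊆ SetValued.image f K) :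
    ∃ K' ⊆ K, IsContinuum K' ∧ M ⊆ SetValued.image f K' ∧
      ∀ x ∈ K', ((f x : Set I) ∩ M).Nonempty := by
  obtain ⟨a, haM, ha⟩ := hM.1.exists_isLeast hM.2.nonempty
  obtain ⟨b, hbM, hb⟩ := hM.1.exists_isGreatest hM.2.nonempty
  have hMo := hM.2.isPreconnected.ordConnected
  have hKo := hK.2.isPreconnected.ordConnected
  let P : Set (I × I) := {p | p ∈ K ×ˢ K ∧ a ∈ f p.1 ∧ b ∈ f p.2}
  have hP : IsCompact P := by
    have : P = K ×ˢ K ∩ ((fun p : I × I => (p.1, a)) ⁻¹' graph f ∩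
        (fun p : I × I => (p.2, b)) ⁻¹' graph f) := rfl
    rw [this]
    exact (hK.1.prod hK.1).inter_right
      ((hG.preimage (by fun_prop)).inter (hG.preimage (by fun_prop)))
  obtain ⟨c₀, hc₀, hc₀'⟩ := mem_image_iff.1 (hKM haM)
  obtain ⟨d₀, hd₀, hd₀'⟩ := mem_image_iff.1 (hKM hbM)
  -- Take the closest pair reaching the two ends of `M`. A point between them whose values miss `M`
  -- has a value beyond one end, and the intermediate values would give a closer pair.
  obtain ⟨⟨c, d⟩, ⟨⟨hc, hd⟩, hca, hdb⟩, hmin⟩ := hP.exists_isMinOn ⟨(c₀, d₀), ⟨hc₀, hd₀⟩, hc₀', hd₀'⟩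
    (f := fun p : I × I => dist p.1 p.2) (by fun_prop)
  have hsub : uIcc c d ⊆ K := hKo.uIcc_subset hc hd
  have hcon : ∀ u v : I, IsContinuum (uIcc u v) := fun u v => isContinuum_Icc inf_le_sup
  have himo : ∀ u v : I, (SetValued.image f (uIcc u v)).OrdConnected := fun u v =>
    ((hcon u v).setValued_image hG hI).2.isPreconnected.ordConnected
  refine ⟨uIcc c d, hsub, hcon c d, fun t ht => (himo c d).out (mem_image_iff.2 ⟨c, left_mem_uIcc, hca⟩)
    (mem_image_iff.2 ⟨d, right_mem_uIcc, hdb⟩) ⟨ha ht, hb ht⟩, fun x hx => ?_⟩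
  by_contra hempty
  have hout : ∀ y ∈ f x, y ∉ M := fun y hy hyM => hempty ⟨y, hy, hyM⟩
  have hxc : x ≠ c := fun h => hout a (h ▸ hca) haM
  have hxd : x ≠ d := fun h => hout b (h ▸ hdb) hbM
  obtain ⟨y, hy⟩ := (f x).nonempty
  rcases lt_or_ge b y with h | h
  · obtain ⟨x', hx', hb'⟩ := mem_image_iff.1 ((himo c x).out
      (mem_image_iff.2 ⟨c, left_mem_uIcc, hca⟩) (mem_image_iff.2 ⟨x, right_mem_uIcc, hy⟩)
      ⟨ha hbM, h.le⟩)
    have hx'd : x' ∈ uIcc c d := uIcc_subset_uIcc_left hx hx'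
    have h1 : dist c d ≤ dist c x' := isMinOn_iff.1 hmin (c, x') ⟨⟨hc, hsub hx'd⟩, hca, hb'⟩
    by_cases hx'x : x' = x
    · subst hx'x
      exact absurd h1 (not_le.2 (dist_lt_dist_of_mem_uIcc hx'd hxd))
    · exact absurd h1 (not_le.2 ((dist_lt_dist_of_mem_uIcc hx' hx'x).trans
        (dist_lt_dist_of_mem_uIcc hx hxd)))
  · have hya : y < a := by
      by_contra hcon'
      exact hout y hy (hMo.out haM hbM ⟨not_lt.1 hcon', h⟩)
    obtain ⟨x', hx', ha'⟩ := mem_image_iff.1 ((himo d x).out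
      (mem_image_iff.2 ⟨x, right_mem_uIcc, hy⟩) (mem_image_iff.2 ⟨d, left_mem_uIcc, hdb⟩)
      ⟨hya.le, ha hbM⟩)
    rw [uIcc_comm] at hx
    have hx'd : x' ∈ uIcc d c := uIcc_subset_uIcc_left hx hx'
    have h1 : dist c d ≤ dist x' d := isMinOn_iff.1 hmin (x', d) ⟨⟨hsub (uIcc_comm c d ▸ hx'd), hd⟩, ha', hdb⟩
    rw [dist_comm c d, dist_comm x' d] at h1
    by_cases hx'x : x' = x
    · subst hx'x
      exact absurd h1 (not_le.2 (dist_lt_dist_of_mem_uIcc hx'd hxc))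
    · exact absurd h1 (not_le.2 ((dist_lt_dist_of_mem_uIcc hx' hx'x).trans
        (dist_lt_dist_of_mem_uIcc hx hxc)))

/-- A chain of covering continua can be shrunk so that every point of each of them has a value in
the next one. -/
theorem exists_tight_chain (hG : IsClosed (graph f)) (hI : ∀ x, (f x : Set I).OrdConnected) (t : ℕ) :
    ∀ K : ℕ → Set I, (∀ i, IsContinuum (K i)) → (∀ i < t, K (i + 1) ⊆ SetValued.image f (K i)) →
      ∃ K' : ℕ → Set I, (∀ i, IsContinuum (K' i)) ∧ (∀ i, K' i ⊆ K i) ∧ K' t = K t ∧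
        ∀ i < t, K' (i + 1) ⊆ SetValued.image f (K' i) ∧
          ∀ x ∈ K' i, ((f x : Set I) ∩ K' (i + 1)).Nonempty := by
  induction t with
  | zero => exact fun K hK _ => ⟨K, hK, fun i => subset_rfl, rfl, by simp⟩
  | succ t ih =>
    intro K hK hcov
    -- The chain is tightened from its end, since each set is shrunk relative to its already shrunk
    -- successor.
    obtain ⟨K₁, h1, h2, h3, h4⟩ := ih (fun i => K (i + 1)) (fun i => hK _)
      (fun i hi => hcov (i + 1) (by omega))
    obtain ⟨K₀, h5, h6, h7, h8⟩ := exists_subcontinuum_image_meets hG hI (hK 0) (h1 0)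
      ((h2 0).trans (hcov 0 (by omega)))
    refine ⟨cons K₀ K₁, ?_, ?_, h3, ?_⟩
    · rintro (_ | i)
      exacts [h6, h1 i]
    · rintro (_ | i)
      exacts [h5, h2 i]
    · rintro (_ | i) hi
      · exact ⟨h7, h8⟩
      · exact h4 i (by omega)

/-- A chain of covering continua that returns over its starting set is followed by a closed
orbit segment. -/
theorem exists_closed_walk (hG : IsClosed (graph f)) (hI : ∀ x, (f x : Set I).OrdConnected) {t : ℕ}
    {K : ℕ → Set I} (hK : ∀ i, IsContinuum (K i))
    (hcov : ∀ i < t, K (i + 1) ⊆ SetValued.image f (K i)) (hret : K 0 ⊆ K t) :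
    ∃ z : ℕ → I, z t = z 0 ∧ (∀ i < t, z (i + 1) ∈ f (z i)) ∧ ∀ i ≤ t, z i ∈ K i := by
  obtain ⟨K', hK', hsub, hend, htight⟩ := exists_tight_chain hG hI t K hK hcov
  -- `C` is a continuum of pairs of start and end points of walks. Tightness makes each extension
  -- fibre a nonempty interval, so connectedness survives every step.
  have key : ∀ i ≤ t, ∃ C : Set (I × I), IsContinuum C ∧ Prod.snd '' C = K' i ∧
      ∀ p ∈ C, ∃ z : ℕ → I, z 0 = p.1 ∧ z i = p.2 ∧ (∀ j < i, z (j + 1) ∈ f (z j)) ∧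
        ∀ j ≤ i, z j ∈ K' j := by
    intro i
    induction i with
    | zero =>
      refine fun _ => ⟨(fun x => (x, x)) '' K' 0, (hK' 0).image (by fun_prop), ?_, ?_⟩
      · rw [image_image]; simp
      · rintro _ ⟨x, hx, rfl⟩
        refine ⟨fun _ => x, rfl, rfl, by simp, fun j hj => ?_⟩
        obtain rfl : j = 0 := by omega
        exact hx
    | succ i ih =>
      intro hi
      obtain ⟨C, hC, hC2, hCz⟩ := ih (by omega)
      obtain ⟨hcov', hmeet⟩ := htight i (by omega)
      have hmem : ∀ p ∈ C, p.2 ∈ K' i := fun p hp => hC2 ▸ ⟨p, hp, rfl⟩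
      let E : Set ((I × I) × I) := {q | q.1 ∈ C ∧ q.2 ∈ f q.1.2 ∧ q.2 ∈ K' (i + 1)}
      have hE : IsCompact E := by
        have : E = C ×ˢ K' (i + 1) ∩ (fun q : (I × I) × I => (q.1.2, q.2)) ⁻¹' graph f := by
          ext q
          simp only [E, graph, mem_ofPred_eq, mem_inter_iff, mem_prod, mem_preimage]
          tauto
        rw [this]
        exact (hC.1.prod (hK' _).1).inter_right (hG.preimage (by fun_prop))
      have hEc : IsConnected E := by
        refine ⟨?_, isPreconnected_of_fibers hE hC.2.isPreconnected (fun q hq => hq.1)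
          (fun c hc => ?_) (fun c hc => ?_)⟩
        · obtain ⟨p, hp⟩ := hC.2.nonempty
          obtain ⟨y, hy, hy'⟩ := hmeet _ (hmem p hp)
          exact ⟨(p, y), hp, hy, hy'⟩
        · obtain ⟨y, hy, hy'⟩ := hmeet _ (hmem c hc)
          exact ⟨y, hc, hy, hy'⟩
        · have : {b | (c, b) ∈ E} = (f c.2 : Set I) ∩ K' (i + 1) := by
            ext b; simp [E, hc]
          rw [this]
          exact ((hI _).inter (hK' _).2.isPreconnected.ordConnected).isPreconnected
      refine ⟨(fun q : (I × I) × I => (q.1.1, q.2)) '' E,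
        IsContinuum.image ⟨hE, hEc⟩ (by fun_prop), ?_, ?_⟩
      · rw [image_image]
        ext y
        constructor
        · rintro ⟨q, hq, rfl⟩
          exact hq.2.2
        · intro hy
          obtain ⟨x, hx, hy'⟩ := mem_image_iff.1 (hcov' hy)
          rw [← hC2] at hx
          obtain ⟨p, hp, rfl⟩ := hx
          exact ⟨(p, y), ⟨hp, hy', hy⟩, rfl⟩
      · rintro _ ⟨⟨p, y⟩, ⟨hp, hy, hy'⟩, rfl⟩
        obtain ⟨z, hz0, hzi, hzo, hzK⟩ := hCz p hp
        refine ⟨Function.update z (i + 1) y, ?_, ?_, fun j hj => ?_, fun j hj => ?_⟩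
        · rw [Function.update_of_ne (by omega)]; exact hz0
        · simp
        · rcases Nat.lt_succ_iff_lt_or_eq.1 hj with h | rfl
          · rw [Function.update_of_ne (by omega), Function.update_of_ne (by omega)]
            exact hzo j h
          · rw [Function.update_self, Function.update_of_ne (by omega), hzi]
            exact hy
        · rcases Nat.le_succ_iff.1 hj with h | rfl
          · rw [Function.update_of_ne (by omega)]
            exact hzK j h
          · rw [Function.update_self]
            exact hy'
  obtain ⟨C, hC, hC2, hCz⟩ := key t le_rfl
  have hfst : ∀ p ∈ C, p.1 ∈ K' t := fun p hp => by
    obtain ⟨z, hz0, -, -, hzK⟩ := hCz p hp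
    rw [hend]
    exact hret (hsub 0 (hz0 ▸ hzK 0 (Nat.zero_le t)))
  obtain ⟨m, hm, hm'⟩ := (hK' t).1.exists_isLeast (hK' t).2.nonempty
  obtain ⟨M, hM, hM'⟩ := (hK' t).1.exists_isGreatest (hK' t).2.nonempty
  obtain ⟨p, hp, hpm⟩ : m ∈ Prod.snd '' C := hC2 ▸ hm
  obtain ⟨q, hq, hqM⟩ : M ∈ Prod.snd '' C := hC2 ▸ hM
  -- The end points fill `K' t`, which contains all the start points, so somewhere on `C` the two
  -- agree.
  obtain ⟨x, hx, hxx⟩ := hC.2.isPreconnected.intermediate_value₂ hp hq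
    (f := Prod.snd) (g := Prod.fst) continuous_snd.continuousOn continuous_fst.continuousOn
    (hpm ▸ hm' (hfst p hp)) (hqM ▸ hM' (hfst q hq))
  obtain ⟨z, hz0, hzt, hzo, hzK⟩ := hCz x hx
  exact ⟨z, by rw [hzt, hz0, hxx], hzo, fun i hi => hsub i (hzK i hi)⟩

/-! ### Cycles whose period is not a power of two. -/

theorem iterate_shift {α : Type*} (w : ℕ → α) (m : ℕ) :
    (fun (x : ℕ → α) i => x (i + 1))^[m] w = fun i => w (m + i) := by
  induction m generalizing w with
  | zero => simp
  | succ m ih =>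
    rw [Function.iterate_succ_apply, ih]
    funext i
    exact congrArg w (by ring)

/-- A closed orbit segment of length `3 n` that is not a threefold repetition yields a cycle whose
period is not a power of two. -/
theorem exists_cycle_of_closed_walk {n : ℕ} (hn : 0 < n) {z : ℕ → I} (hz : z (3 * n) = z 0)
    (hzo : ∀ i < 3 * n, z (i + 1) ∈ f (z i)) {j : ℕ} (hj : j ≤ 2 * n) (hne : z (n + j) ≠ z j) :
    ∃ p : ℕ, HasCycleOfPeriod f p ∧ ¬ ∃ k : ℕ, p = 2 ^ k := by
  set t := 3 * n with ht
  have ht0 : 0 < t := by omega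
  let w : ℕ → I := fun i => z (i % t)
  have hwz : ∀ i ≤ t, w i = z i := fun i hi => by
    rcases hi.lt_or_eq with h | rfl
    · simp only [w, Nat.mod_eq_of_lt h]
    · simp only [w, Nat.mod_self, hz]
  have hw : IsOrbit f w := by
    intro i
    have h1 := hzo (i % t) (Nat.mod_lt _ ht0)
    rw [← hwz _ (Nat.mod_lt _ ht0)] at h1
    have h2 : w (i + 1) = w (i % t + 1) := by simp only [w, Nat.mod_add_mod]
    rwa [h2]
  have hper : ∀ i, w (t + i) = w i := fun i => by simp [w]
  let shift : (ℕ → I) → (ℕ → I) := fun x i => x (i + 1)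
  have hshift : ∀ m, Function.IsPeriodicPt shift m w ↔ ∀ i, w (m + i) = w i := fun m => by
    rw [Function.IsPeriodicPt, Function.IsFixedPt, iterate_shift, funext_iff]
  have hpt : Function.IsPeriodicPt shift t w := (hshift t).2 hper
  refine ⟨Function.minimalPeriod shift w, ⟨w, hw, ⟨hpt.minimalPeriod_pos ht0,
    (hshift _).1 (Function.isPeriodicPt_minimalPeriod shift w)⟩,
    fun m hm => ((hshift m).2 hm.2).minimalPeriod_le hm.1⟩, ?_⟩
  rintro ⟨k, hk⟩
  have hdvd : Function.minimalPeriod shift w ∣ 3 * n := hpt.minimalPeriod_dvd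
  -- A power of two is coprime to 3, so dividing `3 * n` it divides `n`; the walk would then repeat
  -- after `n` steps.
  have hdvd' : Function.minimalPeriod shift w ∣ n := by
    refine Nat.Coprime.dvd_of_dvd_mul_left ?_ hdvd
    rw [hk]
    exact Nat.Coprime.pow_left k (by norm_num)
  have h3 := (hshift n).1 (Function.isPeriodicPt_iff_minimalPeriod_dvd.2 hdvd') j
  rw [hwz _ (by omega), hwz _ (by omega)] at h3
  exact hne h3

/-- Three orbit segments of length `n` forming a closed one, not all equal, yield a cycle whose
period is not a power of two. -/
theorem exists_cycle_of_three_walks {n : ℕ} (hn : 0 < n) {u v w : ℕ → I}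
    (hu : ∀ i < n, u (i + 1) ∈ f (u i)) (hv : ∀ i < n, v (i + 1) ∈ f (v i))
    (hw : ∀ i < n, w (i + 1) ∈ f (w i)) (huv : u n = v 0) (hvw : v n = w 0) (hwu : w n = u 0)
    {j : ℕ} (hj : j ≤ n) (hne : w j ≠ v j) :
    ∃ p : ℕ, HasCycleOfPeriod f p ∧ ¬ ∃ k : ℕ, p = 2 ^ k := by
  let z : ℕ → I := fun i => if i < n then u i else if i < 2 * n then v (i - n) else w (i - 2 * n)
  have z1 : ∀ i ≤ n, z i = u i := fun i hi => by
    rcases hi.lt_or_eq with h | rfl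
    · simp [z, h]
    · have : i < 2 * i := by omega
      simp [z, this, huv]
  have z2 : ∀ i ≤ n, z (n + i) = v i := fun i hi => by
    rcases hi.lt_or_eq with h | rfl
    · have : n + i < 2 * n := by omega
      simp [z, this]
    · have h1 : i + i = 2 * i := by omega
      have h2 : ¬ 2 * i < i := by omega
      simp [z, h1, h2, hvw]
  have z3 : ∀ i, z (2 * n + i) = w i := fun i => by
    have h1 : ¬ 2 * n + i < n := by omega
    simp [z, h1]
  refine exists_cycle_of_closed_walk hn (z := z) (j := n + j) ?_ (fun i hi => ?_) (by omega) ?_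
  · rw [show 3 * n = 2 * n + n by ring, z3, z1 0 (by omega), hwu]
  · by_cases h1 : i < n
    · rw [z1 i h1.le, z1 (i + 1) h1]
      exact hu i h1
    by_cases h2 : i < 2 * n
    · obtain ⟨k, rfl⟩ := Nat.exists_eq_add_of_le (not_lt.1 h1)
      rw [z2 k (by omega), add_assoc, z2 (k + 1) (by omega)]
      exact hv k (by omega)
    · obtain ⟨k, rfl⟩ := Nat.exists_eq_add_of_le (not_lt.1 h2)
      rw [z3 k, add_assoc, z3 (k + 1)]
      exact hw k (by omega)
  · rw [z2 j hj, show n + (n + j) = 2 * n + j by ring, z3]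
    exact hne

theorem exists_walk_of_mem_iterate {n : ℕ} : ∀ {x y : I}, y ∈ (SetValued.image f)^[n] {x} →
    ∃ z : ℕ → I, z 0 = x ∧ z n = y ∧ ∀ i < n, z (i + 1) ∈ f (z i) := by
  induction n with
  | zero => exact fun {x y} h => ⟨fun _ => x, rfl, (mem_singleton_iff.1 h).symm, by simp⟩
  | succ n ih =>
    intro x y h
    rw [Function.iterate_succ_apply'] at h
    obtain ⟨y', hy', hy⟩ := mem_image_iff.1 h
    obtain ⟨z, h0, hn, ho⟩ := ih hy'
    refine ⟨Function.update z (n + 1) y, ?_, by simp, fun j hj => ?_⟩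
    · rw [Function.update_of_ne (by omega)]; exact h0
    · rcases Nat.lt_succ_iff_lt_or_eq.1 hj with h | rfl
      · rw [Function.update_of_ne (by omega), Function.update_of_ne (by omega)]
        exact ho j h
      · rw [Function.update_self, Function.update_of_ne (by omega), hn]
        exact hy

/-- Two disjoint continua that an iterate of `f` maps onto the whole interval yield a cycle whose
period is not a power of two. -/
theorem exists_cycle_of_disjoint (hG : IsClosed (graph f)) (hI : ∀ x, (f x : Set I).OrdConnected)
    {n : ℕ} (hn : 0 < n) {J₁ J₂ : Set I} (h₁ : IsContinuum J₁) (h₂ : IsContinuum J₂)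
    (hd : Disjoint J₁ J₂) (hJ₁ : (SetValued.image f)^[n] J₁ = univ)
    (hJ₂ : (SetValued.image f)^[n] J₂ = univ) :
    ∃ p : ℕ, HasCycleOfPeriod f p ∧ ¬ ∃ k : ℕ, p = 2 ^ k := by
  -- The walk starts in `J₁` and visits `J₁`, `J₂`, `J₁` at times `n`, `2 * n`, `3 * n`;
  -- disjointness rules out period `n`.
  let B : ℕ → Set I := fun k => if k = 2 then J₂ else J₁
  have hB : ∀ k, IsContinuum (B k) := fun k => by
    by_cases h : k = 2 <;> simp only [B, h, if_true, if_false] <;> assumption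
  have hBn : ∀ k, (SetValued.image f)^[n] (B k) = univ := fun k => by
    by_cases h : k = 2 <;> simp only [B, h, if_true, if_false] <;> assumption
  let K : ℕ → Set I := fun i => (SetValued.image f)^[i % n] (B (i / n))
  have hKn : ∀ k, K (k * n) = B k := fun k => by simp [K, hn]
  obtain ⟨z, hz, hzo, hzK⟩ := exists_closed_walk hG hI (t := 3 * n) (K := K)
    (fun i => (hB _).iterate_image hG hI _) (fun i hi => by
      by_cases h : (i + 1) % n = 0
      · have h1 : i % n + 1 = n := by
          have h2 := Nat.mod_lt i hn
          by_contra h3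
          have : (i + 1) % n = i % n + 1 := by
            rw [← Nat.mod_add_mod, Nat.mod_eq_of_lt (by omega)]
          omega
        have h2 : SetValued.image f (K i) = univ := by
          have h3 := Function.iterate_succ_apply' (SetValued.image f) (i % n) (B (i / n))
          rw [Nat.succ_eq_add_one, h1, hBn] at h3
          exact h3.symm
        rw [h2]
        exact subset_univ _
      · have h1 : (i + 1) / n = i / n :=
          Nat.succ_div_of_not_dvd fun hd => h (Nat.mod_eq_zero_of_dvd hd)
        have h2 : (i + 1) % n = i % n + 1 := by
          have h3 := Nat.div_add_mod i n
          have h4 := Nat.div_add_mod (i + 1) n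
          rw [h1] at h4
          omega
        simp only [K, h1, h2, Function.iterate_succ_apply']
        exact subset_rfl)
    (by
      have h0 := hKn 0
      rw [zero_mul] at h0
      rw [h0, hKn 3]
      exact subset_rfl)
  refine exists_cycle_of_closed_walk hn hz hzo (j := n) (by omega) fun heq => ?_
  have h1 := hzK (1 * n) (by omega)
  have h2 := hzK (2 * n) (by omega)
  rw [hKn] at h1 h2
  rw [show n + n = 2 * n by ring] at heq
  rw [one_mul, ← heq] at h1
  exact disjoint_left.1 hd h1 h2

/-! ### Proof of part 2. -/

/-- The sequences that are orbits up to `m` and agree with a fixed sequence from `m` on form a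
continuum. -/
theorem isContinuum_fixed_tail (hG : IsClosed (graph f)) (hI : ∀ x, (f x : Set I).OrdConnected)
    (y : ℕ → I) (m : ℕ) :
    IsContinuum {x : ℕ → I | (∀ i < m, x i ∈ f (x (i + 1))) ∧ ∀ j, x (m + j) = y j} := by
  induction m with
  | zero =>
    have : {x : ℕ → I | (∀ i < 0, x i ∈ f (x (i + 1))) ∧ ∀ j, x (0 + j) = y j} = {y} := by
      ext x; simp [funext_iff]
    rw [this]
    exact ⟨isCompact_singleton, isConnected_singleton⟩
  | succ m ih =>
    convert isContinuum_cons hG hI ih using 1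
    ext x
    constructor
    · rintro ⟨h1, h2⟩
      exact ⟨h1 0 (Nat.succ_pos m), fun i hi => h1 (i + 1) (Nat.succ_lt_succ hi), fun j => by
        rw [← h2 j]; exact congrArg x (by ring)⟩
    · rintro ⟨h0, h1, h2⟩
      refine ⟨fun i hi => ?_, fun j => ?_⟩
      · cases i with
        | zero => exact h0
        | succ i => exact h1 i (Nat.lt_of_succ_lt_succ hi)
      · rw [← h2 j]; exact congrArg x (by ring)

theorem iterate_mem_of_mem_inverseLimit {x : ℕ → I} (hx : x ∈ inverseLimit f) (n k : ℕ) :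
    x k ∈ (SetValued.image f)^[n] {x (k + n)} := by
  induction n generalizing k with
  | zero => exact mem_singleton _
  | succ n ih =>
    rw [Function.iterate_succ_apply']
    refine mem_image_iff.2 ⟨x (k + 1), ?_, hx k⟩
    rw [show k + (n + 1) = k + 1 + n by ring]
    exact ih (k + 1)

/-- If the inverse limit is irreducible between two points sharing a coordinate `b` that an iterate
of `f` spreads over the whole interval, then `f` has a cycle whose period is not a power of two. -/
theorem exists_cycle_of_common_coordinate (hG : IsClosed (graph f))
    (hI : ∀ x, (f x : Set I).OrdConnected) (hnt : (inverseLimit f).Nontrivial) {n : ℕ} (hn : 0 < n)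
    {x y : ℕ → I} (hxy : IsIrreducibleBetween (inverseLimit f) x y) (heq : x n = y n)
    (hspread : (SetValued.image f)^[n] {x n} = univ) :
    ∃ p : ℕ, HasCycleOfPeriod f p ∧ ¬ ∃ k : ℕ, p = 2 ^ k := by
  obtain ⟨-, hx, hy, hirr⟩ := hxy
  set b := x n with hb
  by_cases hs : ∃ s, s ≠ b ∧ b ∈ (SetValued.image f)^[n] {s}
  · obtain ⟨s, hsb, hs⟩ := hs
    obtain ⟨u, hu0, hun, hu⟩ := exists_walk_of_mem_iterate
      (hspread ▸ mem_univ b : b ∈ (SetValued.image f)^[n] {b})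
    obtain ⟨v, hv0, hvn, hv⟩ := exists_walk_of_mem_iterate
      (hspread ▸ mem_univ s : s ∈ (SetValued.image f)^[n] {b})
    obtain ⟨w, hw0, hwn, hw⟩ := exists_walk_of_mem_iterate hs
    exact exists_cycle_of_three_walks hn hu hv hw (hun.trans hv0.symm) (hvn.trans hw0.symm)
      (hwn.trans hu0.symm) (Nat.zero_le n) (by rwa [hw0, hv0])
  -- Now only `b` returns to `b` in `n` steps, so both threads equal `b` at every positive multiple
  -- of `n`.
  · push Not at hs
    have hmult : ∀ x ∈ inverseLimit f, x n = b → ∀ k, x ((k + 1) * n) = b := by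
      intro x hx hxb k
      induction k with
      | zero => simpa using hxb
      | succ k ih =>
        by_contra hne
        have := iterate_mem_of_mem_inverseLimit hx n ((k + 1) * n)
        rw [ih, show (k + 1) * n + n = (k + 1 + 1) * n by ring] at this
        exact hs _ hne this
    have hxm := hmult x hx rfl
    have hym := hmult y hy heq.symm
    by_cases htail : ∀ j, x (n + j) = y (n + j)
    -- If the tails agree, irreducibility makes the continuum of threads with that tail all of `X`;
    -- then every coordinate of every thread is `b`.
    · exfalso
      set C : Set (ℕ → I) :=
        {w | (∀ i < n, w i ∈ f (w (i + 1))) ∧ ∀ j, w (n + j) = x (n + j)} with hC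
      have hCc : IsContinuum C := isContinuum_fixed_tail hG hI (fun j => x (n + j)) n
      have hCX : C = inverseLimit f := by
        refine hirr C ?_ hCc ⟨fun i _ => hx i, fun j => rfl⟩
          ⟨fun i _ => hy i, fun j => (htail j).symm⟩
        rintro w ⟨h1, h2⟩ i
        rcases lt_or_ge i n with h | h
        · exact h1 i h
        · obtain ⟨j, rfl⟩ := Nat.exists_eq_add_of_le h
          rw [h2, add_assoc, h2]
          exact hx (n + j)
      have hconst : ∀ w ∈ inverseLimit f, w 0 = b := by
        intro w hw
        obtain ⟨w', hw', hww'⟩ := eval_zero_subset_eval n ⟨w, hw, rfl⟩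
        rw [← hCX] at hw'
        have h1 : w' n = w 0 := hww'
        rw [← h1]
        exact hw'.2 0
      have hall : ∀ j, ∀ w ∈ inverseLimit f, w j = b := by
        intro j
        induction j with
        | zero => exact hconst
        | succ j ih => exact fun w hw => ih (fun i => w (i + 1)) fun i => hw (i + 1)
      obtain ⟨w, hw, w', hw', hne⟩ := hnt
      exact hne (funext fun j => (hall j w hw).trans (hall j w' hw').symm)
    -- If the tails differ inside some block between consecutive multiples of `n`, that block read
    -- backwards gives two different walks from `b` to `b`.
    · push Not at htail
      obtain ⟨j, hj⟩ := htail
      have hdm := Nat.div_add_mod' j n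
      have hr := Nat.mod_lt j hn
      set k := j / n
      set r := j % n
      have hwalk : ∀ x ∈ inverseLimit f, ∀ i < n,
          x ((k + 1) * n + n - (i + 1)) ∈ f (x ((k + 1) * n + n - i)) := by
        intro x hx i hi
        have := hx ((k + 1) * n + n - (i + 1))
        rwa [show (k + 1) * n + n - (i + 1) + 1 = (k + 1) * n + n - i by omega] at this
      have hidx : (k + 1) * n + n - (n - r) = n + j := by
        rw [← hdm, add_mul, one_mul]; omega
      have e0 : ∀ x : ℕ → I, (∀ k, x ((k + 1) * n) = b) → x ((k + 1) * n + n - 0) = b := by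
        intro x hx
        rw [Nat.sub_zero, show (k + 1) * n + n = (k + 1 + 1) * n by ring, hx]
      have en : ∀ x : ℕ → I, (∀ k, x ((k + 1) * n) = b) → x ((k + 1) * n + n - n) = b := by
        intro x hx
        rw [Nat.add_sub_cancel, hx]
      refine exists_cycle_of_three_walks hn (u := fun i => x ((k + 1) * n + n - i))
        (v := fun i => x ((k + 1) * n + n - i)) (w := fun i => y ((k + 1) * n + n - i))
        (hwalk x hx) (hwalk x hx) (hwalk y hy) ((en x hxm).trans (e0 x hxm).symm)
        ((en x hxm).trans (e0 y hym).symm) ((en y hym).trans (e0 x hxm).symm) (j := n - r)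
        (Nat.sub_le n r) ?_
      simp only [hidx]
      exact hj.symm

/-- If `f` is organic and its inverse limit is indecomposable, then `f` has a cycle whose period is
not a power of two. -/
theorem exists_cycle_of_isIndecomposable (hG : IsClosed (graph f))
    (hI : ∀ x, (f x : Set I).OrdConnected) (horg : IsOrganic f)
    (hind : IsIndecomposable (inverseLimit f)) :
    ∃ p : ℕ, HasCycleOfPeriod f p ∧ ¬ ∃ k : ℕ, p = 2 ^ k := by
  obtain ⟨x, hx⟩ := hind.exists_seq_irreducible
  have hcon : ∀ u v : I, IsContinuum (uIcc u v) := fun u v => isContinuum_Icc inf_le_sup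
  have hev : ∀ i j, i ≠ j → ∀ᶠ n in atTop,
      (SetValued.image f)^[n] (uIcc (x i n) (x j n)) = univ := by
    intro i j hij
    obtain ⟨-, hxi, hxj, -⟩ := hx i j hij
    obtain ⟨n, -, hn⟩ := horg _ hxi _ hxj (hx i j hij)
    -- The image of the interval between the coordinates at `m + 1` contains the one at `m`, so
    -- spreading persists for larger indices and a common `n` exists.
    refine eventually_atTop.2 ⟨n, fun m hm => ?_⟩
    induction m, hm using Nat.le_induction with
    | base => exact hn
    | succ m _ ih =>
      rw [Function.iterate_succ_apply]
      refine eq_univ_of_univ_subset (ih.symm.subset.trans (iterate_image_mono ?_ m))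
      exact ((hcon _ _).setValued_image hG hI).2.isPreconnected.ordConnected.uIcc_subset
        (mem_image_iff.2 ⟨_, left_mem_uIcc, hxi m⟩) (mem_image_iff.2 ⟨_, right_mem_uIcc, hxj m⟩)
  have hev' : ∀ᶠ n in atTop, ∀ i j : Fin 4, i ≠ j →
      (SetValued.image f)^[n] (uIcc (x i n) (x j n)) = univ := by
    refine eventually_all.2 fun i => eventually_all.2 fun j => ?_
    by_cases hij : i = j
    · exact Eventually.of_forall fun n h => absurd hij h
    · exact (hev i j fun h => hij (Fin.ext h)).mono fun n hn _ => hn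
  obtain ⟨n, hn, hn0⟩ := (hev'.and (eventually_gt_atTop 0)).exists
  let e := Tuple.sort fun i : Fin 4 => x i n
  have hmono : Monotone ((fun i : Fin 4 => x i n) ∘ e) := Tuple.monotone_sort _
  let c : Fin 4 → I := fun i => x (e i) n
  have hc : ∀ i j : Fin 4, i ≤ j → c i ≤ c j := fun i j h => hmono h
  have hfull : ∀ i j : Fin 4, i < j → (SetValued.image f)^[n] (Icc (c i) (c j)) = univ := by
    intro i j hij
    rw [← uIcc_of_le (hc i j hij.le)]
    exact hn _ _ (e.injective.ne hij.ne)
  -- Four points suffice: a gap between the middle two separates the outer intervals, and a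
  -- coincidence gives a shared coordinate that spreads by itself.
  by_cases h12 : c 1 = c 2
  · have hne : (e 1 : ℕ) ≠ e 2 := fun h => by
      have := e.injective (Fin.ext h)
      exact absurd this (by decide)
    refine exists_cycle_of_common_coordinate hG hI hind.2.1 hn0 (hx _ _ hne) h12 ?_
    have := hfull 1 2 (by decide)
    rwa [← h12, Icc_self] at this
  · refine exists_cycle_of_disjoint hG hI hn0 (isContinuum_Icc (hc 0 1 (by decide)))
      (isContinuum_Icc (hc 2 3 (by decide))) ?_ (hfull 0 1 (by decide)) (hfull 2 3 (by decide))
    have hlt : c 1 < c 2 := lt_of_le_of_ne (hc 1 2 (by decide)) h12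
    exact disjoint_left.2 fun t ht ht' => absurd (ht'.1.trans ht.2) (not_le.2 hlt)

end SetValued

theorem theorem1p1 (f : unitInterval → TopologicalSpace.NonemptyCompacts unitInterval)
    (husc : SetValued.IsUSC f) (hivp : SetValued.HasIVP f) :
    (SetValued.IsAlmostNonfissile ((SetValued.thinDomain f).domRestrict f) →
      SetValued.IsLight ((SetValued.thinDomain f).domRestrict f) →
      (∃ p : ℕ, SetValued.HasCycleOfPeriod f p ∧ ¬ ∃ k : ℕ, p = 2 ^ k) →
      ∃ K : Set (ℕ → unitInterval),
        K ⊆ SetValued.inverseLimit f ∧ SetValued.IsIndecomposable K) ∧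
    (SetValued.IsOrganic f →
      SetValued.IsIndecomposable (SetValued.inverseLimit f) →
      ∃ p : ℕ, SetValued.HasCycleOfPeriod f p ∧ ¬ ∃ k : ℕ, p = 2 ^ k) := by
  have hG := SetValued.isClosed_graph husc
  have hI := SetValued.ordConnected_of_hasIVP husc hivp
  exact ⟨fun hanf hl ⟨_, hp, hp2⟩ =>
      SetValued.exists_isIndecomposable_of_cycle husc hivp hanf hl hp hp2,
    fun horg hind => SetValued.exists_cycle_of_isIndecomposable hG hI horg hind⟩
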